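/- A partial $\stackrel{\bullet}{\sqcup}$-algebra is a (possibly empty) set $A$ with a partial binary operation $\stackrel{\bullet}{\sqcup}$ on $A$. For sets $S,T$, the disjoint union $S\stackrel{\bullet}{\cup}T$ equals $S\cup T$ if $S\cap T=\emptyset$ and is undefined otherwise. A disjoint-union representation of $(A,\stackrel{\bullet}{\sqcup})$ is a bijection $\theta$ from $A$ onto a collection of subsets of some set $X$ that is closed under $\stackrel{\bullet}{\cup}$ wherever it is defined, such that for all $a,b\in A$, $a\stackrel{\bullet}{\sqcup}b$ is defined if and only if $\theta(a)\stackrel{\bullet}{\cup}\theta(b)$ is defined, and in that case $\theta(a\stackrel{\bullet}{\sqcup}b)=\theta(a)\stackrel{\bullet}{\cup}\theta(b)$. A set $U\subseteq A$ is $\stackrel{\bullet}{\sqcup}$-prime if $a\stackrel{\bullet}{\sqcup}b\in U$ implies $a\in U$ or $b\in U$; bi-closed if $a\stackrel{\bullet}{\sqcup}b\in U$ whenever $a\stackrel{\bullet}{\sqcup}b$ is defined and $a\in U$ or $b\in U$; and pairwise incombinable if $a\stackrel{\bullet}{\sqcup}b$ is undefined for all $a,b\in U$ (including $a=b$). Encode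 a finite partial $\stackrel{\bullet}{\sqcup}$-algebra with domain $\{0,\dots,n-1\}$ as the bit string consisting of $n$ in unary, followed by the $n^3$ truth values, in lexicographic order of $(a,b,c)$, of "$a\stackrel{\bullet}{\sqcup}b$ is defined and equal to $c$". **Theorem.** The problem of determining whether a finite partial $\stackrel{\bullet}{\sqcup}$-algebra has a disjoint-union representation is in $\mathbf{NP}$. Moreover, membership in $\mathbf{NP}$ is witnessed by the following certificates. A certificate for an algebra $A$ with domain $\{0,\dots,n-1\}$ is a family of $\stackrel{\bullet}{\sqcup}$-prime, bi-closed, pairwise-incombinable subsets $S_{a,b},T_{a,b}\subseteq A$ ($a,b\in A$), written as a string of $2n^3$ bits, such that exactly one of $a,b$ belongs to $S_{a,b}$ whenever $a\neq b$, and $a,b\in T_{a,b}$ whenever $a\stackrel{\bullet}{\sqcup}b$ is undefined. It is decidable in polynomial time on a (multi-stack) Turing machine whether a pair of bit strings consists of the encoding of a finite partial $\stackrel{\bullet}{\sqcup}$-algebra and a certificate for it; and a bit string encodes a finite partial $\stackrel{\bullet}{\sqcup}$-algebra having a disjoint-union representation if and only if it has such a certificate, of length bounded by a fixed polynomial in the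 length of the bit string. -/

import Mathlib

universe u

namespace DisjointUnion

/-- A partial algebra with one partial binary operation on the (possibly empty) domain `A`:
`join a b = some c` says that the operation is defined at `(a, b)` with value `c`, and
`join a b = none` that it is undefined there. -/
structure PartialAlgebra (A : Type u) where
  join : A → A → Option A

/-- Partial-algebra homomorphism: the operation is defined at `(a, b)` if and only if it is defined
at the pair of images, and then the values correspond. -/
def IsHom {A B : Type u} (𝒜 : PartialAlgebra A) (ℬ : PartialAlgebra B) (θ : A → B) : Prop :=
  ∀ a b : A, ℬ.join (θ a) (θ b) = (𝒜.join a b).map θ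

/-- Isomorphism: a bijective partial-algebra homomorphism. -/
def IsIso {A B : Type u} (𝒜 : PartialAlgebra A) (ℬ : PartialAlgebra B) (θ : A → B) : Prop :=
  IsHom 𝒜 ℬ θ ∧ Function.Bijective θ

/-- A collection of subsets of the base `X` that is closed under disjoint union, wherever
disjoint union is defined. -/
structure DisjointUnionAlgebraOfSets (X : Type u) where
  sets : Set (Set X)
  union_mem : ∀ S ∈ sets, ∀ T ∈ sets, Disjoint S T → S ∪ T ∈ sets

open Classical in
/-- The disjoint-union partial algebra of sets, as a partial algebra: the operation takes `S`, `T`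
to `S ∪ T` if `S` and `T` are disjoint, and is undefined otherwise. -/
noncomputable def DisjointUnionAlgebraOfSets.toPartialAlgebra {X : Type u}
    (𝒟 : DisjointUnionAlgebraOfSets X) : PartialAlgebra 𝒟.sets where
  join S T :=
    if h : Disjoint S.1 T.1 then some ⟨S.1 ∪ T.1, 𝒟.union_mem S.1 S.2 T.1 T.2 h⟩ else none

/-- A disjoint-union representation is an isomorphism to a disjoint-union partial algebra
of sets, over some base set. -/
def HasDisjointUnionRepresentation {A : Type u} (𝒜 : PartialAlgebra A) : Prop :=
  ∃ (X : Type u) (𝒟 : DisjointUnionAlgebraOfSets X) (θ : A → 𝒟.sets),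
    IsIso 𝒜 𝒟.toPartialAlgebra θ

section Subsets

variable {A : Type u} (𝒜 : PartialAlgebra A) (U : Set A)

/-- If `a ⊔ b` is defined and lies in `U`, then `a ∈ U` or `b ∈ U`. -/
def IsJoinPrime : Prop :=
  ∀ a b c : A, 𝒜.join a b = some c → c ∈ U → a ∈ U ∨ b ∈ U

/-- If `a ⊔ b` is defined, and `a ∈ U` or `b ∈ U`, then `a ⊔ b ∈ U`. -/
def IsBiClosed : Prop :=
  ∀ a b c : A, 𝒜.join a b = some c → a ∈ U ∨ b ∈ U → c ∈ U

/-- If `a, b ∈ U` (possibly `a = b`), then `a ⊔ b` is undefined. -/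
def IsPairwiseIncombinable : Prop :=
  ∀ a b : A, a ∈ U → b ∈ U → 𝒜.join a b = none

end Subsets

/-- Two families of subsets of `{0, …, n-1}`, both indexed by the pairs of elements. -/
structure SetFamily (n : ℕ) where
  S : Fin n → Fin n → Finset (Fin n)
  T : Fin n → Fin n → Finset (Fin n)

/-- All sets of the family are prime, bi-closed and pairwise incombinable, `S a b` contains exactly
one of `a`, `b` whenever `a ≠ b`, and `T a b` contains `a` and `b` whenever the operation is
undefined at `(a, b)`. -/
structure SetFamily.Certifies {n : ℕ} (C : SetFamily n) (𝒜 : PartialAlgebra (Fin n)) : Prop where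
  prime_S : ∀ a b, IsJoinPrime 𝒜 (C.S a b)
  biClosed_S : ∀ a b, IsBiClosed 𝒜 (C.S a b)
  incombinable_S : ∀ a b, IsPairwiseIncombinable 𝒜 (C.S a b)
  prime_T : ∀ a b, IsJoinPrime 𝒜 (C.T a b)
  biClosed_T : ∀ a b, IsBiClosed 𝒜 (C.T a b)
  incombinable_T : ∀ a b, IsPairwiseIncombinable 𝒜 (C.T a b)
  separates : ∀ a b, a ≠ b → Xor (a ∈ C.S a b) (b ∈ C.S a b)
  covers : ∀ a b, 𝒜.join a b = none → a ∈ C.T a b ∧ b ∈ C.T a b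

/-- The usual encoding of a finite relational structure as a bit string: the size `n` of the domain
in unary (`n` times `false`, then `true`), followed by the `n ^ 3` truth values, in lexicographic
order of `(a, b, c)`, of the relation `a ⊔ b = c`. -/
def PartialAlgebra.encode {n : ℕ} (𝒜 : PartialAlgebra (Fin n)) : List Bool :=
  List.replicate n false ++ true ::
    (List.finRange n).flatMap fun a => (List.finRange n).flatMap fun b =>
      (List.finRange n).map fun c => decide (𝒜.join a b = some c)

/-- The family as a string of `2 * n ^ 3` bits: for each pair `(a, b)`, in lexicographic order, the
characteristic vector of `S a b` followed by that of `T a b`. -/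
def SetFamily.encode {n : ℕ} (C : SetFamily n) : List Bool :=
  (List.finRange n).flatMap fun a => (List.finRange n).flatMap fun b =>
    ((List.finRange n).map fun c => decide (c ∈ C.S a b)) ++
      (List.finRange n).map fun c => decide (c ∈ C.T a b)

/-- A relation between bit strings is decidable in polynomial time if its characteristic function
is computed by a (multi-stack) Turing machine in time polynomial in the length of the input. The
input is the string `x` followed by the string `w`, with the bits of `x` and those of `w` marked
as such. -/
def PolyTimeDecidable (R : List Bool → List Bool → Prop) : Prop :=
  ∃ f : List Bool × List Bool → Bool,
    (∀ x w, f (x, w) = true ↔ R x w) ∧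
    Nonempty (Turing.TM2ComputableInPolyTime
      (Computability.encodingProd
        (Computability.encodingList Bool) (Computability.encodingList Bool)).encode
      Computability.encodeBool f)

/-- `R x w` (read: `w` is a certificate for `x`) is decidable in polynomial time, and the members
of `L` are exactly the strings that have a certificate of polynomially bounded length. -/
def IsPolyTimeVerifier (R : List Bool → List Bool → Prop) (L : Language Bool) : Prop :=
  PolyTimeDecidable R ∧
    ∃ p : Polynomial ℕ, ∀ x : List Bool,
      x ∈ L ↔ ∃ w : List Bool, w.length ≤ p.eval x.length ∧ R x w

/-- The complexity class NP. -/
def NP : Set (Language Bool) :=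
  {L | ∃ R : List Bool → List Bool → Prop, IsPolyTimeVerifier R L}

/-- The decision problem: the strings that encode a finite partial algebra which has a
disjoint-union representation. -/
def RepresentabilityProblem : Language Bool :=
  {x | ∃ (n : ℕ) (𝒜 : PartialAlgebra (Fin n)),
    x = 𝒜.encode ∧ HasDisjointUnionRepresentation 𝒜}

/-- `x` encodes a finite partial algebra, and `w` encodes a family of prime, bi-closed, pairwise
incombinable sets that certifies it. -/
def CertificateRelation (x w : List Bool) : Prop :=
  ∃ (n : ℕ) (𝒜 : PartialAlgebra (Fin n)) (C : SetFamily n),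
    x = 𝒜.encode ∧ w = C.encode ∧ C.Certifies 𝒜

end DisjointUnion

/-!
A finite partial algebra has a disjoint-union representation if and only if it has enough prime,
bi-closed, pairwise incombinable subsets to tell elements apart and to witness that the operation is
undefined: a point `x` of the base of a representation `θ` yields such a subset `{a | x ∈ θ a}`
(`IsIso.isPoint`), and conversely a family of such subsets is itself the base of a representation
(`hasDisjointUnionRepresentation_of_isPoint`). Only one subset is needed for each pair of elements
and each of the two tasks, and these `2 * n ^ 2` subsets of `{0, …, n - 1}` are the certificate.
Pairs for which a task does not arise are served by the empty set.

What remains is to check a certificate in polynomial time on a machine with stacks. After the size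
`n` has been read, the rest of the input consists of two tables, `J` for the operation and `W` for
the certificate, and their being correct is a first-order property of two bit strings of lengths
`n ^ 3` and `2 * n ^ 3` (`GoodTables`, `certificateRelation_iff`). So it suffices to decide
first-order properties. The predicate `Decides` says that this is possible for a given property.
It is closed under Boolean connectives, under quantification over the domain (`Decides.all`, a loop
of length `n`), and it holds for the atomic properties, which are read off by walking along a
stack (`Decides.of_walkable`): the position of an entry of a table is a sum of products of variables
and powers of `n`, and a walk of that length is a sequence of nested loops
(`Walkable.add`, `Walkable.mul`). Equality of variables is of this form as well, since a variable is
stored in unary.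

Machines are obtained from structured programs (`Prog`) with sequential composition, loops and
conditionals. `Runs` describes the effect and the running time of a program, in every machine that
contains its code, and is established for composite programs from their parts.
-/

namespace DisjointUnion

open Turing Function

/-! ### Structured programs for machines with stacks -/

section StackPrograms

variable {K : Type} {Γ : K → Type} {σ : Type}

/-- Rename the jump targets of a statement. -/
def mapLabel {Λ Λ' : Type} (f : Λ → Λ') : TM2.Stmt Γ Λ σ → TM2.Stmt Γ Λ' σ
  | .push k g q => .push k g (mapLabel f q)
  | .peek k g q => .peek k g (mapLabel f q)
  | .pop k g q => .pop k g (mapLabel f q)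
  | .load g q => .load g (mapLabel f q)
  | .branch g q₁ q₂ => .branch g (mapLabel f q₁) (mapLabel f q₂)
  | .goto g => .goto fun v => f (g v)
  | .halt => .halt

theorem stepAux_mapLabel [DecidableEq K] {Λ Λ' : Type} (f : Λ → Λ') (q : TM2.Stmt Γ Λ σ) (v : σ)
    (S : ∀ k, List (Γ k)) :
    TM2.stepAux (mapLabel f q) v S =
      ⟨(TM2.stepAux q v S).l.map f, (TM2.stepAux q v S).var, (TM2.stepAux q v S).stk⟩ := by
  induction q generalizing v S with
  | branch g q₁ q₂ h₁ h₂ => cases h : g v <;> simp [mapLabel, h, h₁, h₂]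
  | _ => simp_all [mapLabel]

variable (Γ σ) in
/-- Structured programs acting on stacks. A basic instruction is a straight-line statement that
ends in a jump to its unique label; a test is a statement that jumps to `true` or to `false`
(it may modify the memory). -/
inductive Prog : Type
  | basic (q : TM2.Stmt Γ Unit σ)
  | seq (p q : Prog)
  | loop (test : TM2.Stmt Γ Bool σ) (body : Prog)
  | cond (test : TM2.Stmt Γ Bool σ) (p q : Prog)

namespace Prog

/-- The labels of the machine code of a program. -/
def Label : Prog Γ σ → Type
  | basic _ => Unit
  | seq p q => p.Label ⊕ q.Label
  | loop _ p => Option p.Label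
  | cond _ p q => Option (p.Label ⊕ q.Label)

/-- Programs have finitely many labels. -/
@[reducible]
def labelFintype : (p : Prog Γ σ) → Fintype p.Label
  | basic _ => inferInstanceAs (Fintype Unit)
  | seq p q =>
    letI := p.labelFintype
    letI := q.labelFintype
    inferInstanceAs (Fintype (p.Label ⊕ q.Label))
  | loop _ p =>
    letI := p.labelFintype
    inferInstanceAs (Fintype (Option p.Label))
  | cond _ p q =>
    letI := p.labelFintype
    letI := q.labelFintype
    inferInstanceAs (Fintype (Option (p.Label ⊕ q.Label)))

/-- The label at which the execution of a program starts. -/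
def entry : (p : Prog Γ σ) → p.Label
  | basic _ => ()
  | seq p _ => Sum.inl p.entry
  | loop _ _ => none
  | cond _ _ _ => none

/-- The machine code of a program, for a machine with label type `Λ` into which the labels of the
program are embedded by `emb`. When the program is finished, it jumps to the label `exit`. -/
def code {Λ : Type} : (p : Prog Γ σ) → (emb : p.Label → Λ) → (exit : Λ) → p.Label →
    TM2.Stmt Γ Λ σ
  | basic q, _, exit, _ => mapLabel (fun _ => exit) q
  | seq p q, emb, exit, l =>
    match l with
    | .inl l => p.code (fun l => emb (.inl l)) (emb (.inr q.entry)) l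
    | .inr l => q.code (fun l => emb (.inr l)) exit l
  | loop t p, emb, exit, l =>
    match l with
    | none => mapLabel (fun b => if b then emb (some p.entry) else exit) t
    | some l => p.code (fun l => emb (some l)) (emb none) l
  | cond t p q, emb, exit, l =>
    match l with
    | none =>
      mapLabel (fun b => if b then emb (some (.inl p.entry)) else emb (some (.inr q.entry))) t
    | some (.inl l) => p.code (fun l => emb (some (.inl l))) exit l
    | some (.inr l) => q.code (fun l => emb (some (.inr l))) exit l

end Prog

variable [DecidableEq K]

/-- `Runs p s s' t`: in every machine that contains the code of `p`, a computation that enters this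
code in the situation `s` (the internal state and the stacks) leaves it in the situation `s'`, after
at most `t` steps. Quantifying over all machines is what makes programs composable. -/
def Runs (p : Prog Γ σ) (s s' : σ × (∀ k, List (Γ k))) (t : ℕ) : Prop :=
  ∀ (Λ : Type) (M : Λ → TM2.Stmt Γ Λ σ) (emb : p.Label → Λ) (exit : Λ),
    (∀ l, M (emb l) = p.code emb exit l) →
    ∃ i ≤ t, (flip bind (TM2.step M))^[i] (some ⟨some (emb p.entry), s.1, s.2⟩) =
      some ⟨some exit, s'.1, s'.2⟩

/-- The test or instruction `q`, executed in the situation `s`, ends in the situation `s'` with a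
jump to `l`. -/
def Steps {Λ : Type} (q : TM2.Stmt Γ Λ σ) (s s' : σ × (∀ k, List (Γ k))) (l : Λ) : Prop :=
  TM2.stepAux q s.1 s.2 = ⟨some l, s'.1, s'.2⟩

theorem Steps.step {Λ Λ' : Type} {M : Λ' → TM2.Stmt Γ Λ' σ} {q : TM2.Stmt Γ Λ σ}
    {s s' : σ × (∀ k, List (Γ k))} {l : Λ} (h : Steps q s s' l) {l₀ : Λ'} {f : Λ → Λ'}
    (hM : M l₀ = mapLabel f q) :
    flip bind (TM2.step M) (some ⟨some l₀, s.1, s.2⟩) = some ⟨some (f l), s'.1, s'.2⟩ := by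
  simp only [Steps] at h
  simp [flip, hM, stepAux_mapLabel, h]

namespace Runs

variable {p q : Prog Γ σ} {s s' s'' : σ × (∀ k, List (Γ k))} {t t' : ℕ}

theorem mono (h : Runs p s s' t) (ht : t ≤ t') : Runs p s s' t' := fun Λ M emb exit hM =>
  let ⟨i, hi, e⟩ := h Λ M emb exit hM
  ⟨i, hi.trans ht, e⟩

theorem congr {s₁ s₁' : σ × (∀ k, List (Γ k))} (h : Runs p s s' t) (hs : s = s₁) (hs' : s' = s₁')
    (ht : t ≤ t') : Runs p s₁ s₁' t' := by
  subst hs hs'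
  exact h.mono ht

theorem basic {q : TM2.Stmt Γ Unit σ} (h : Steps q s s' ()) : Runs (.basic q) s s' 1 :=
  fun _ _ _ _ hM => ⟨1, le_rfl, h.step (hM ())⟩

theorem seq (h : Runs p s s' t) (h' : Runs q s' s'' t') : Runs (.seq p q) s s'' (t + t') := by
  intro Λ M emb exit hM
  obtain ⟨i, hi, e⟩ := h Λ M (fun l => emb (.inl l)) (emb (.inr q.entry)) fun l => hM (.inl l)
  obtain ⟨j, hj, e'⟩ := h' Λ M (fun l => emb (.inr l)) exit fun l => hM (.inr l)
  refine ⟨j + i, by omega, ?_⟩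
  rw [Function.iterate_add_apply]
  exact (congrArg _ e).trans e'

theorem cond_true {test : TM2.Stmt Γ Bool σ} (ht : Steps test s s' true) (h : Runs p s' s'' t) :
    Runs (.cond test p q) s s'' (t + 1) := by
  intro Λ M emb exit hM
  obtain ⟨i, hi, e⟩ := h Λ M (fun l => emb (some (.inl l))) exit fun l => hM (some (.inl l))
  refine ⟨i + 1, by omega, ?_⟩
  rw [Function.iterate_succ_apply]
  exact (congrArg _ (ht.step (hM none))).trans e

theorem cond_false {test : TM2.Stmt Γ Bool σ} (ht : Steps test s s' false) (h : Runs q s' s'' t) :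
    Runs (.cond test p q) s s'' (t + 1) := by
  intro Λ M emb exit hM
  obtain ⟨i, hi, e⟩ := h Λ M (fun l => emb (some (.inr l))) exit fun l => hM (some (.inr l))
  refine ⟨i + 1, by omega, ?_⟩
  rw [Function.iterate_succ_apply]
  exact (congrArg _ (ht.step (hM none))).trans e

theorem loop_false {test : TM2.Stmt Γ Bool σ} (ht : Steps test s s' false) :
    Runs (.loop test p) s s' 1 :=
  fun _ _ _ _ hM => ⟨1, le_rfl, ht.step (hM none)⟩

theorem loop_true {s₁ s₂ : σ × (∀ k, List (Γ k))} {test : TM2.Stmt Γ Bool σ}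
    (ht : Steps test s s₁ true) (h : Runs p s₁ s₂ t) (h' : Runs (.loop test p) s₂ s' t') :
    Runs (.loop test p) s s' (t' + (t + 1)) := by
  intro Λ M emb exit hM
  obtain ⟨i, hi, e⟩ := h Λ M (fun l => emb (some l)) (emb none) fun l => hM (some l)
  obtain ⟨j, hj, e'⟩ := h' Λ M emb exit hM
  refine ⟨j + (i + 1), by omega, ?_⟩
  rw [Function.iterate_add_apply, Function.iterate_succ_apply]
  exact (congrArg _ ((congrArg _ (ht.step (hM none))).trans e)).trans e'

/-- A loop whose successive situations before the test are `g 0, …, g m`. -/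
theorem loop {test : TM2.Stmt Γ Bool σ} (m : ℕ) (g h : ℕ → σ × (∀ k, List (Γ k)))
    (ht : ∀ i < m, Steps test (g i) (h i) true) (hp : ∀ i < m, Runs p (h i) (g (i + 1)) t)
    (hm : Steps test (g m) s' false) : Runs (.loop test p) (g 0) s' (m * (t + 1) + 1) := by
  induction m generalizing g h with
  | zero => simpa using loop_false hm
  | succ m ih =>
    refine (loop_true (ht 0 m.succ_pos) (hp 0 m.succ_pos) (ih (fun i => g (i + 1))
      (fun i => h (i + 1)) (fun i hi => ht _ (by omega)) (fun i hi => hp _ (by omega)) hm)).mono ?_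
    linarith

end Runs

/-- The program followed by a halting statement, as a machine with input stack `k₀`, output stack
`k₁` and initial memory `v`. -/
def Prog.machine [Fintype K] (p : Prog Γ σ) [Fintype σ] (k₀ k₁ : K) [Fintype (Γ k₀)]
    (v : σ) : FinTM2 where
  K := K
  k₀ := k₀
  k₁ := k₁
  Γ := Γ
  Λ := Option p.Label
  main := some p.entry
  ΛFin := letI := p.labelFintype; inferInstance
  σ := σ
  initialState := v
  m l := match l with
    | none => .halt
    | some l => p.code some none l

/-- The machine of a program halts one step after the program is finished. -/
theorem Runs.machine [Fintype K] {p : Prog Γ σ} [Fintype σ] {k₀ k₁ : K} [Fintype (Γ k₀)] {v v' : σ}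
    {S S' : ∀ k, List (Γ k)} {t : ℕ} (h : Runs p (v, S) (v', S') t) :
    ∃ i ≤ t + 1, (flip bind (p.machine k₀ k₁ v).step)^[i] (some ⟨some (some p.entry), v, S⟩) =
      some ⟨none, v', S'⟩ := by
  obtain ⟨i, hi, e⟩ := h (Option p.Label) (p.machine k₀ k₁ v).m some none fun l => rfl
  refine ⟨1 + i, by omega, ?_⟩
  rw [Function.iterate_add_apply]
  exact (congrArg _ e).trans rfl

end StackPrograms

/-! ### The stacks of the verifier -/

/-- The stacks of the verifier, apart from the input stack. There is a table for the relation
`a ⊔ b = c` (`table false`) and one for the certificate (`table true`). The value `x ≤ n` of the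
`j`-th variable is kept in unary, as a stack `lo j` of length `x` together with a stack `hi j` of
length `n - x`. -/
inductive Key
  | output
  | table (r : Bool)
  | aux
  | tmp
  | lo (j : Fin 8)
  | hi (j : Fin 8)
  deriving DecidableEq, Fintype

/-- The stack alphabets: two marked copies of `Bool` on the input stack `none`, and `Bool`
elsewhere. -/
@[reducible]
def Alphabet : Option Key → Type
  | none => Bool ⊕ Bool
  | some _ => Bool

/-- The internal memory: a flag that holds truth values, and a register for a symbol that has been
read from a stack. -/
abbrev Memory : Type := Bool × Option Bool

/-- All the stacks, given the input stack and the others. -/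
def allStacks (i : List (Bool ⊕ Bool)) (m : Key → List Bool) : ∀ k, List (Alphabet k)
  | none => i
  | some k => m k

/-- The situation with flag `f` and an empty register. -/
def conf (f : Bool) (i : List (Bool ⊕ Bool)) (m : Key → List Bool) :
    Memory × ∀ k, List (Alphabet k) :=
  ((f, none), allStacks i m)

@[simp]
theorem allStacks_none (i : List (Bool ⊕ Bool)) (m : Key → List Bool) :
    allStacks i m none = i := rfl

@[simp]
theorem allStacks_some (i : List (Bool ⊕ Bool)) (m : Key → List Bool) (k : Key) :
    allStacks i m (some k) = m k := rfl

@[simp]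
theorem update_allStacks_none (i i' : List (Bool ⊕ Bool)) (m : Key → List Bool) :
    update (allStacks i m) none i' = allStacks i' m := by
  funext k
  cases k <;> simp [update, allStacks]

@[simp]
theorem update_allStacks_some (i : List (Bool ⊕ Bool)) (m : Key → List Bool) (k : Key)
    (L : List Bool) : update (allStacks i m) (some k) L = allStacks i (update m k L) := by
  funext k'
  cases k' with
  | none => simp [update, allStacks]
  | some k' =>
    by_cases h : k' = k
    · subst h; simp
    · simp [h]

/-! ### Moving the contents of stacks -/

/-- Move one symbol from the stack `k` to the stack `k'`; false if there is none. -/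
def moveTest (k k' : Key) : TM2.Stmt Alphabet Bool Memory :=
  .pop (some k) (fun v o => (v.1, o)) <| .branch (fun v => v.2.isSome)
    (.push (some k') (fun v => v.2.getD false) <| .load (fun v => (v.1, none)) <|
      .goto fun _ => true)
    (.goto fun _ => false)

/-- The instruction that does nothing. -/
def skip : Prog Alphabet Memory := .basic (.goto fun _ => ())

variable {f : Bool} {i : List (Bool ⊕ Bool)} {m : Key → List Bool} {k k' : Key}

theorem steps_moveTest_cons {b : Bool} {l : List Bool} (h : m k = b :: l) (hk : k ≠ k') :
    Steps (moveTest k k') (conf f i m)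
      (conf f i (update (update m k l) k' (b :: m k'))) true := by
  simp [Steps, moveTest, conf, h, hk.symm]

theorem steps_moveTest_nil (h : m k = []) :
    Steps (moveTest k k') (conf f i m) (conf f i m) false := by
  have : update m k [] = m := by rw [← h, update_eq_self]
  simp [Steps, moveTest, conf, h, this]

theorem steps_flag : Steps (.goto fun v : Memory => v.1) (conf f i m) (conf f i m) f := rfl

theorem runs_skip {s : Memory × ∀ k, List (Alphabet k)} : Runs skip s s 1 :=
  Runs.basic (by simp [Steps])

/-- Move the contents of the stack `k` to the stack `k'`. -/
def moveAll (k k' : Key) : Prog Alphabet Memory := .loop (moveTest k k') skip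

theorem runs_moveAll (hk : k ≠ k') :
    Runs (moveAll k k') (conf f i m)
      (conf f i (update (update m k []) k' ((m k).reverse ++ m k'))) ((m k).length * 2 + 1) := by
  let g : ℕ → Key → List Bool := fun x =>
    update (update m k ((m k).drop x)) k' (((m k).take x).reverse ++ m k')
  have h := Runs.loop (test := moveTest k k') (p := skip) (t := 1) (s' := conf f i (g (m k).length))
    (m k).length (fun x => conf f i (g x)) (fun x => conf f i (g (x + 1))) ?_
    (fun _ _ => runs_skip) ?_
  · simpa [g, moveAll, update_eq_self] using h
  · intro x hx
    have e : (m k).drop x = (m k)[x] :: (m k).drop (x + 1) := List.drop_eq_getElem_cons hx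
    have e' : ((m k).take (x + 1)).reverse = (m k)[x] :: ((m k).take x).reverse := by
      rw [List.take_succ_eq_append_getElem hx, List.reverse_append]
      rfl
    convert steps_moveTest_cons (f := f) (i := i) (m := g x)
      (by simpa only [g, update_of_ne hk, update_self] using e) hk using 2
    funext j
    rcases eq_or_ne j k' with rfl | h1
    · simp [g, e']
    rcases eq_or_ne j k with rfl | h2
    · simp [g, h1]
    · simp [g, h1, h2]
  · exact steps_moveTest_nil (by simp [g, hk])

/-- Move (at most) `c` symbols from the stack `T` to the auxiliary stack. -/
def move (T : Key) (c : ℕ) (m : Key → List Bool) : Key → List Bool :=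
  update (update m T ((m T).drop c)) .aux (((m T).take c).reverse ++ m .aux)

theorem move_move {T : Key} (hT : T ≠ .aux) (c c' : ℕ) (m : Key → List Bool) :
    move T c' (move T c m) = move T (c + c') m := by
  funext j
  simp only [move, update_apply, hT, if_true, if_false, List.take_add, List.drop_drop,
    List.reverse_append, List.append_assoc]
  split_ifs <;> simp_all

theorem move_apply_of_ne {T : Key} {c : ℕ} (h : k ≠ T) (h' : k ≠ .aux) : move T c m k = m k := by
  simp [move, h, h']

theorem length_move {T : Key} {c : ℕ} (hT : T ≠ .aux) :
    (move T c m T).length = (m T).length - c := by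
  simp [move, hT]

/-- Move the auxiliary stack back. -/
theorem restore_move {T : Key} {c : ℕ} (hT : T ≠ .aux) (h : m .aux = []) :
    update (update (move T c m) .aux []) T ((move T c m .aux).reverse ++ move T c m T) = m := by
  funext j
  simp only [move, update_apply, hT, if_true, if_false, List.reverse_reverse, h, List.append_nil]
  split_ifs <;> simp_all

/-- Execute `p` as many times as there are symbols on the stack `k`, using the stack `k'` to
restore the stack `k`. -/
def forLoop (k k' : Key) (p : Prog Alphabet Memory) : Prog Alphabet Memory :=
  .seq (.loop (moveTest k k') p) (moveAll k' k)

/-! ### Walking along a table -/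

/-- The contents of the stacks, apart from the input stack: `n` is the size of the domain, `J` and
`W` are the tables and `e j` is the value of the `j`-th variable. -/
def mem (n : ℕ) (J W : List Bool) (e : Fin 8 → ℕ) : Key → List Bool
  | .table r => cond r W J
  | .lo j => List.replicate (e j) false
  | .hi j => List.replicate (n - e j) false
  | _ => []

/-- The variables `5, 6, 7` are never assigned. Thus they are available for loops of length `n`. -/
def Admissible (n : ℕ) (e : Fin 8 → ℕ) : Prop :=
  (∀ j, e j ≤ n) ∧ ∀ j, 5 ≤ j → e j = 0

/-- Some program moves `c n e` symbols from the stack `T` to the auxiliary stack, clears the flag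
if there are not that many, and uses only the stacks in `U` besides. -/
def Walkable (T : Key) (U : Set Key) (c : ℕ → (Fin 8 → ℕ) → ℕ) : Prop :=
  ∃ (p : Prog Alphabet Memory) (q : Polynomial ℕ), ∀ n J W e, Admissible n e → ∀ f m,
    (∀ k ∈ U, m k = mem n J W e k) →
    Runs p (conf f [] m) (conf (f && decide (c n e ≤ (m T).length)) [] (move T (c n e) m))
      (q.eval n)

/-- A walk of one step. On an empty stack it only clears the flag, in accordance with `move`. -/
theorem Walkable.one {T : Key} (hT : T ≠ .aux) : Walkable T ∅ fun _ _ => 1 := by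
  refine ⟨.basic (.pop (some T) (fun v o => (v.1, o)) <| .branch (fun v => v.2.isSome)
    (.push (some .aux) (fun v => v.2.getD false) <| .load (fun v => (v.1, none)) <|
      .goto fun _ => ()) (.load (fun _ => (false, none)) <| .goto fun _ => ())), 1, ?_⟩
  intro n J W e _ f m _
  rw [Polynomial.eval_one]
  refine Runs.basic ?_
  cases h : m T with
  | nil =>
    have h1 : update m T [] = m := by rw [← h, update_eq_self]
    simp [Steps, conf, h, h1, move]
  | cons b l => simp [Steps, conf, h, move, hT.symm]

theorem Walkable.add {T : Key} {U : Set Key} {c c' : ℕ → (Fin 8 → ℕ) → ℕ} (hT : T ≠ .aux)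
    (hU : T ∉ U) (hU' : .aux ∉ U) (h : Walkable T U c) (h' : Walkable T U c') :
    Walkable T U fun n e => c n e + c' n e := by
  obtain ⟨p, q, hp⟩ := h
  obtain ⟨p', q', hp'⟩ := h'
  refine ⟨.seq p p', q + q', fun n J W e he f m hm => ?_⟩
  rw [Polynomial.eval_add]
  refine (hp n J W e he f m hm).seq ?_
  convert hp' n J W e he _ (move T (c n e) m) ?_ using 2
  · rw [length_move hT, Bool.and_assoc, ← Bool.decide_and]
    congr 2
    simp only [eq_iff_iff]
    omega
  · exact (move_move hT _ _ _).symm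
  · intro k hk
    rw [move_apply_of_ne (fun h => hU (by rwa [← h])) (fun h => hU' (by rwa [← h])), hm k hk]

theorem Walkable.mono {T : Key} {U U' : Set Key} {c : ℕ → (Fin 8 → ℕ) → ℕ} (hU : U ⊆ U')
    (h : Walkable T U c) : Walkable T U' c := by
  obtain ⟨p, q, hp⟩ := h
  exact ⟨p, q, fun n J W e he f m hm => hp n J W e he f m fun k hk => hm k (hU hk)⟩

/-- A walk may be repeated as often as the length of a stack `k` says. -/
theorem Walkable.mul {T : Key} {U : Set Key} {c a : ℕ → (Fin 8 → ℕ) → ℕ} (hT : T ≠ .aux)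
    (hU : T ∉ U) (hU' : .aux ∉ U) (hk : k ∉ U) (hk' : k' ∉ U) (hkk : k ≠ k') (hkT : k ≠ T)
    (hkT' : k' ≠ T) (hka : k ≠ .aux) (hka' : k' ≠ .aux)
    (ha : ∀ n J W e, Admissible n e → a n e ≤ n ∧ (mem n J W e k).length = a n e ∧
      mem n J W e k' = [])
    (h : Walkable T U c) : Walkable T (insert k (insert k' U)) fun n e => a n e * c n e := by
  obtain ⟨p, q, hp⟩ := h
  refine ⟨forLoop k k' p, (Polynomial.X * (q + 1) + 1) + (Polynomial.X * 2 + 1),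
    fun n J W e he f m hm => ?_⟩
  obtain ⟨han, hak, hak'⟩ := ha n J W e he
  have hmk : (m k).length = a n e := by rw [hm k (by simp), hak]
  have hmk' : m k' = [] := by rw [hm k' (by simp), hak']
  -- the stacks after `x` walks, when `y` symbols have been moved from `k` to `k'`
  let g : ℕ → ℕ → Key → List Bool := fun x y =>
    update (update (move T (x * c n e) m) k ((m k).drop y)) k' ((m k).take y).reverse
  -- the flag after `x` walks
  let F : ℕ → Bool := fun x => f && decide (x * c n e ≤ (m T).length)
  have hloop := Runs.loop (test := moveTest k k') (p := p) (t := q.eval n)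
    (s' := conf (F (a n e)) [] (g (a n e) (a n e)))
    (a n e) (fun x => conf (F x) [] (g x x)) (fun x => conf (F x) [] (g x (x + 1))) ?_ ?_ ?_
  · have hmove := runs_moveAll (f := F (a n e)) (i := []) (m := g (a n e) (a n e)) hkk.symm
    refine (hloop.seq hmove).congr ?_ ?_ ?_
    · have h0 : g 0 0 = m := by
        funext j
        simp only [g, move, update_apply, zero_mul, List.drop_zero, List.take_zero,
          List.reverse_nil, List.nil_append]
        split_ifs <;> simp_all only
      simp [F, h0]
    · simp only [F]
      congr 1
      funext j
      simp only [g, update_apply, hkk, hkk.symm, if_true, if_false, ← hmk, List.take_length,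
        List.drop_length, List.reverse_reverse, List.append_nil]
      split_ifs with h1 h2
      · rw [h1, move_apply_of_ne hkT hka]
      · rw [h2, move_apply_of_ne hkT' hka', hmk']
      · rfl
    · simp only [g, update_apply, if_true, List.length_reverse, List.length_take, hmk, min_self,
        Polynomial.eval_add, Polynomial.eval_mul, Polynomial.eval_X, Polynomial.eval_one,
        Polynomial.eval_ofNat]
      gcongr
  · intro x hx
    have e : (m k).drop x = (m k)[x] :: (m k).drop (x + 1) := List.drop_eq_getElem_cons (by omega)
    have hx' : x < (m k).length := by omega
    have e' : ((m k).take (x + 1)).reverse = (m k)[x] :: ((m k).take x).reverse := by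
      rw [List.take_succ_eq_append_getElem hx', List.reverse_append]
      rfl
    convert steps_moveTest_cons (f := F x) (i := []) (m := g x x)
      (by simpa only [g, update_of_ne hkk, update_self] using e) hkk using 2
    funext j
    rcases eq_or_ne j k' with rfl | h1
    · simp [g, e']
    rcases eq_or_ne j k with rfl | h2
    · simp [g, h1]
    · simp [g, h1, h2]
  · intro x hx
    have hg : ∀ y z, g y z T = move T (y * c n e) m T := fun y z => by
      simp [g, update_of_ne hkT.symm, update_of_ne hkT'.symm]
    convert hp n J W e he (F x) (g x (x + 1)) ?_ using 2
    · simp only [F, hg, length_move hT, Bool.and_assoc, ← Bool.decide_and]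
      congr 2
      simp only [eq_iff_iff, add_mul]
      omega
    · funext j
      simp only [g, add_mul, one_mul, ← move_move hT]
      simp only [move, update_apply]
      split_ifs <;> simp_all
    · intro j hj
      have h1 : j ≠ k := fun h => hk (h ▸ hj)
      have h2 : j ≠ k' := fun h => hk' (h ▸ hj)
      have h3 : j ≠ T := fun h => hU (h ▸ hj)
      have h4 : j ≠ .aux := fun h => hU' (h ▸ hj)
      simp only [g, update_of_ne h1, update_of_ne h2, move_apply_of_ne h3 h4]
      exact hm j (by simp [hj])
  · refine steps_moveTest_nil ?_
    simp [g, hkk, ← hmk]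

/-- A walk may be repeated as often as the value of a variable says. -/
theorem Walkable.mul_var {T : Key} {U : Set Key} {c : ℕ → (Fin 8 → ℕ) → ℕ} (j : Fin 8)
    (hT : T ≠ .aux) (hU : T ∉ U) (hU' : .aux ∉ U) (hj : .lo j ∉ U) (hjT : T ≠ .lo j)
    (ht : .tmp ∉ U) (htT : T ≠ .tmp) (h : Walkable T U c) :
    Walkable T (insert (.lo j) (insert .tmp U)) fun n e => e j * c n e :=
  h.mul hT hU hU' hj ht (by simp) hjT.symm htT.symm (by simp) (by simp)
    fun n J W e he => ⟨he.1 j, by simp [mem], by simp [mem]⟩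

/-- A walk may be repeated `n` times, with the help of an idle variable. -/
theorem Walkable.mul_size {T : Key} {U : Set Key} {c : ℕ → (Fin 8 → ℕ) → ℕ} (z : Fin 8)
    (hz : 5 ≤ z) (hT : T ≠ .aux) (hU : T ∉ U) (hU' : .aux ∉ U) (hj : .lo z ∉ U) (hj' : .hi z ∉ U)
    (hjT : T ≠ .lo z) (hjT' : T ≠ .hi z) (h : Walkable T U c) :
    Walkable T (insert (.hi z) (insert (.lo z) U)) fun n e => n * c n e :=
  h.mul hT hU hU' hj' hj (by simp) hjT'.symm hjT.symm (by simp) (by simp)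
    fun n J W e he => ⟨le_rfl, by simp [mem, he.2 z hz], by simp [mem, he.2 z hz]⟩

/-! ### Deciding first-order properties of the tables -/

theorem eval_le_eval (q : Polynomial ℕ) {a b : ℕ} (h : a ≤ b) : q.eval a ≤ q.eval b := by
  simp only [Polynomial.eval_eq_sum_range]
  gcongr

theorem length_mem_le {n : ℕ} {J W : List Bool} {e : Fin 8 → ℕ} (he : Admissible n e) (k : Key) :
    (mem n J W e k).length ≤ n + J.length + W.length := by
  rcases k with _ | r | _ | _ | j | j
  · simp [mem]
  · cases r <;> simp only [mem, cond_true, cond_false] <;> omega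
  · simp [mem]
  · simp [mem]
  · have := he.1 j
    simp only [mem, List.length_replicate]
    omega
  · simp only [mem, List.length_replicate]
    omega

open Classical in
/-- Some program decides, in polynomial time, the property `φ n J W e` of two tables `J`, `W` and
the values of the variables `0, …, d - 1`. It leaves all stacks as they were. -/
def Decides (d : ℕ) (φ : ℕ → List Bool → List Bool → (Fin 8 → ℕ) → Prop) : Prop :=
  ∃ (p : Prog Alphabet Memory) (q : Polynomial ℕ), ∀ n J W e, Admissible n e →
    (∀ j : Fin 8, d ≤ j → e j = 0) → ∀ f,
    Runs p (conf f [] (mem n J W e)) (conf (decide (φ n J W e)) [] (mem n J W e))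
      (q.eval (n + J.length + W.length))

section Decides

variable {d : ℕ} {φ ψ : ℕ → List Bool → List Bool → (Fin 8 → ℕ) → Prop}

theorem Decides.congr (h : Decides d φ) (hφ : ∀ n J W e, φ n J W e ↔ ψ n J W e) : Decides d ψ := by
  have : φ = ψ := by
    funext n J W e
    exact propext (hφ n J W e)
  exact this ▸ h

theorem Decides.not (h : Decides d φ) : Decides d fun n J W e => ¬ φ n J W e := by
  obtain ⟨p, q, hp⟩ := h
  refine ⟨.seq p (.basic (.load (fun v => (!v.1, v.2)) (.goto fun _ => ()))), q + 1,
    fun n J W e he hd f => ?_⟩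
  rw [Polynomial.eval_add, Polynomial.eval_one]
  refine (hp n J W e he hd f).seq (Runs.basic ?_)
  simp [Steps, conf]

theorem Decides.and (h : Decides d φ) (h' : Decides d ψ) :
    Decides d fun n J W e => φ n J W e ∧ ψ n J W e := by
  classical
  obtain ⟨p, q, hp⟩ := h
  obtain ⟨p', q', hp'⟩ := h'
  refine ⟨.seq p (.cond (.goto fun v => v.1) p' skip), q + (q' + 1 + 1),
    fun n J W e he hd f => ?_⟩
  simp only [Polynomial.eval_add, Polynomial.eval_one]
  refine (hp n J W e he hd f).seq ?_
  rw [Bool.decide_and]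
  cases decide (φ n J W e) with
  | true =>
    rw [Bool.true_and]
    exact (Runs.cond_true steps_flag (hp' n J W e he hd true)).mono (Nat.le_succ _)
  | false =>
    rw [Bool.false_and]
    exact (Runs.cond_false steps_flag runs_skip).mono (by omega)

theorem Decides.or (h : Decides d φ) (h' : Decides d ψ) :
    Decides d fun n J W e => φ n J W e ∨ ψ n J W e :=
  (h.not.and h'.not).not.congr fun _ _ _ _ => by tauto

theorem Decides.imp (h : Decides d φ) (h' : Decides d ψ) :
    Decides d fun n J W e => φ n J W e → ψ n J W e :=
  (h.and h'.not).not.congr fun _ _ _ _ => by tauto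

theorem Decides.iff (h : Decides d φ) (h' : Decides d ψ) :
    Decides d fun n J W e => φ n J W e ↔ ψ n J W e :=
  ((h.imp h').and (h'.imp h)).congr fun _ _ _ _ => iff_def.symm

/-- Moving a symbol from `hi j` to `lo j` increments the `j`-th variable. -/
theorem mem_update_succ {n : ℕ} {J W : List Bool} {e : Fin 8 → ℕ} {j : Fin 8} {x : ℕ} :
    update (update (mem n J W (update e j x)) (.hi j) (List.replicate (n - (x + 1)) false))
      (.lo j) (false :: List.replicate x false) = mem n J W (update e j (x + 1)) := by
  funext k
  rcases k with _ | _ | _ | _ | l | l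
  · simp [mem]
  · simp [mem]
  · simp [mem]
  · simp [mem]
  · rcases eq_or_ne l j with rfl | h
    · simp [mem, List.replicate_succ]
    · simp [mem, h]
  · rcases eq_or_ne l j with rfl | h
    · simp [mem]
    · simp [mem, h]

/-- Quantification over the domain, by a loop in which `lo d` counts up and `hi d` counts down. -/
theorem Decides.all (d : Fin 8) (hd5 : d < 5) (h : Decides (d + 1) φ) :
    Decides d fun n J W e => ∀ x < n, φ n J W (update e d x) := by
  classical
  obtain ⟨p, q, hp⟩ := h
  refine ⟨.seq (.basic (.load (fun v => (true, v.2)) (.goto fun _ => ())))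
    (.seq (.loop (.peek (some (.hi d)) (fun v o => (v.1, o)) <| .branch (fun v => v.2.isSome)
        (.load (fun v => (v.1, none)) <| .goto fun _ => true) (.goto fun _ => false))
      (.seq (.cond (.goto fun v => v.1) p skip)
        (.basic (.pop (some (.hi d)) (fun v o => (v.1, o)) <|
          .push (some (.lo d)) (fun v => v.2.getD false) <| .load (fun v => (v.1, none)) <|
          .goto fun _ => ()))))
      (moveAll (.lo d) (.hi d))),
    1 + ((Polynomial.X * ((q + 1 + 1 + 1) + 1) + 1) + (Polynomial.X * 2 + 1)),
    fun n J W e he hd f => ?_⟩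
  have hed : e d = 0 := hd d le_rfl
  simp only [Polynomial.eval_add, Polynomial.eval_one, Polynomial.eval_mul, Polynomial.eval_X,
    Polynomial.eval_ofNat]
  set N := n + J.length + W.length with hN
  refine Runs.seq (s' := conf true [] (mem n J W e)) (Runs.basic (by simp [Steps, conf])) ?_
  -- the flag after `y` rounds; the body is skipped once the flag is cleared
  let F : ℕ → Bool := fun y => decide (∀ x < y, φ n J W (update e d x))
  have hloop := Runs.loop (t := q.eval N + 1 + 1 + 1)
    (test := .peek (some (.hi d)) (fun v o => (v.1, o)) <| .branch (fun v => v.2.isSome)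
        (.load (fun v => (v.1, none)) <| .goto fun _ => true) (.goto fun _ => false))
    (p := .seq (.cond (.goto fun v => v.1) p skip)
        (.basic (.pop (some (.hi d)) (fun v o => (v.1, o)) <|
          .push (some (.lo d)) (fun v => v.2.getD false) <| .load (fun v => (v.1, none)) <|
          .goto fun _ => ())))
    (s' := conf (F n) [] (mem n J W (update e d n)))
    n (fun x => conf (F x) [] (mem n J W (update e d x)))
    (fun x => conf (F x) [] (mem n J W (update e d x))) ?_ ?_ ?_
  · have hmove := runs_moveAll (f := F n) (i := []) (m := mem n J W (update e d n)) (k := .lo d)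
      (k' := .hi d) (by simp)
    refine (hloop.seq hmove).congr ?_ ?_ ?_
    · have h0 : update e d 0 = e := by rw [← hed, update_eq_self]
      simp [F, h0]
    · simp only [F]
      congr 1
      · exact decide_eq_decide.2 Iff.rfl
      funext k
      rcases k with _ | _ | _ | _ | l | l
      · simp [mem]
      · simp [mem]
      · simp [mem]
      · simp [mem]
      · rcases eq_or_ne l d with rfl | h
        · simp [mem, hed]
        · simp [mem, h]
      · rcases eq_or_ne l d with rfl | h
        · simp [mem, hed]
        · simp [mem, h]
    · have hn : n ≤ N := by omega
      simp only [mem, update_self, List.length_replicate]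
      gcongr
  · intro x hx
    obtain ⟨y, hy⟩ : ∃ y, n - x = y + 1 := ⟨n - x - 1, by omega⟩
    simp [Steps, conf, mem, hy, List.replicate_succ]
  · intro x hx
    have hadm : Admissible n (update e d x) := by
      refine ⟨fun j => ?_, fun j hj => ?_⟩
      · rcases eq_or_ne j d with rfl | h
        · simpa using hx.le
        · simpa [h] using he.1 j
      · have : j ≠ d := by rintro rfl; exact absurd hd5 (not_lt.2 hj)
        simpa [this] using he.2 j hj
    have hd' : ∀ j : Fin 8, (d : ℕ) + 1 ≤ j → update e d x j = 0 := fun j hj => by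
      have : j ≠ d := by rintro rfl; omega
      simpa [this] using hd j (by omega)
    refine Runs.seq (s' := conf (F (x + 1)) [] (mem n J W (update e d x))) ?_ (Runs.basic ?_)
    · by_cases hF : ∀ y < x, φ n J W (update e d y)
      · have e1 : F x = true := by simpa [F] using hF
        have e2 : F (x + 1) = decide (φ n J W (update e d x)) := by
          simp only [F, decide_eq_decide]
          exact ⟨fun h => h x (by omega), fun h y hy =>
            (Nat.lt_succ_iff_lt_or_eq.1 hy).elim (hF y) (fun e => e ▸ h)⟩
        rw [e1, e2]
        exact (Runs.cond_true steps_flag (hN ▸ hp n J W _ hadm hd' true)).mono (by omega)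
      · have e1 : F x = false := by simpa [F] using hF
        have e2 : F (x + 1) = false := by
          simp only [F, decide_eq_false_iff_not]
          exact fun h => hF fun y hy => h y (by omega)
        rw [e1, e2]
        exact (Runs.cond_false steps_flag runs_skip).mono (by omega)
    · obtain ⟨y, hy⟩ : ∃ y, n - x = y + 1 := ⟨n - x - 1, by omega⟩
      rw [← mem_update_succ]
      have hy' : n - (x + 1) = y := by omega
      simp [Steps, conf, mem, hy, hy', List.replicate_succ]
  · simp [Steps, conf, mem]

/-- Walk along a stack, look at the symbol that has been reached, and walk back. The truth value is
computed by `g` from the success of the walk and the symbol, which is `none` at the end. -/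
theorem Decides.of_walkable {T : Key} {U : Set Key} {c : ℕ → (Fin 8 → ℕ) → ℕ} (hT : T ≠ .aux)
    (hw : Walkable T U c) (g : Bool → Option Bool → Bool) :
    Decides d fun n J W e =>
      g (decide (c n e ≤ (mem n J W e T).length)) (mem n J W e T)[c n e]? = true := by
  obtain ⟨p, q, hp⟩ := hw
  refine ⟨.seq (.basic (.load (fun v => (true, v.2)) (.goto fun _ => ()))) (.seq p (.seq
    (.basic (.peek (some T) (fun v o => (g v.1 o, v.2)) (.goto fun _ => ())))
    (moveAll .aux T))), 1 + (q + (1 + (Polynomial.X * 2 + 1))), fun n J W e he hd f => ?_⟩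
  simp only [Polynomial.eval_add, Polynomial.eval_one, Polynomial.eval_mul, Polynomial.eval_X,
    Polynomial.eval_ofNat]
  set N := n + J.length + W.length with hN
  refine Runs.seq (s' := conf true [] (mem n J W e)) (Runs.basic (by simp [Steps, conf])) ?_
  refine Runs.seq ((hp n J W e he true _ fun _ _ => rfl).mono (eval_le_eval q (by omega))) ?_
  refine Runs.seq (s' := conf (g (decide (c n e ≤ (mem n J W e T).length)) (mem n J W e T)[c n e]?)
    [] (move T (c n e) (mem n J W e))) (Runs.basic ?_) ?_
  · simp [Steps, conf, move, hT, List.head?_drop]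
  · refine (runs_moveAll hT.symm).congr rfl ?_ ?_
    · rw [restore_move hT rfl]
      congr 1
      simp
    · have h1 : (move T (c n e) (mem n J W e) .aux).length ≤ (mem n J W e T).length := by
        simp only [move, update_self, List.length_append, List.length_reverse, List.length_take]
        simp [mem]
      have h2 := length_mem_le (J := J) (W := W) he T
      omega

end Decides

/-! ### The first-order description of a correct certificate -/

/-- The stack has `c` symbols if a walk of that length succeeds and arrives at the end. -/
theorem Decides.length_eq {d : ℕ} {T : Key} {U : Set Key} {c : ℕ → (Fin 8 → ℕ) → ℕ}
    (hT : T ≠ .aux) (hw : Walkable T U c) :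
    Decides d fun n J W e => (mem n J W e T).length = c n e :=
  (Decides.of_walkable hT hw fun b o => b && o.isNone).congr fun n J W e => by
    simp only [Bool.and_eq_true, decide_eq_true_eq, Option.isNone_iff_eq_none,
      List.getElem?_eq_none_iff]
    omega

/-- Two variables are compared by walking along the unary value of one of them. -/
theorem Decides.var_eq {d : ℕ} (x y : Fin 8) (h : y ≠ x) :
    Decides d fun _ _ _ e => e x = e y :=
  (Decides.length_eq (d := d) (T := .lo x) (by simp)
    ((Walkable.one (T := .lo x) (by simp)).mul_var y (by simp) (by simp) (by simp) (by simp)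
      (by simpa using h.symm) (by simp) (by simp))).congr
    fun n J W e => by simp [mem]

/-- The stacks that hold the values of the variables, and the one that helps to restore them. -/
def counters : Set Key := {k | (∃ j, k = .lo j) ∨ (∃ j, k = .hi j) ∨ k = .tmp}

section Table

variable {r : Bool}

theorem Walkable.add_counters {c c' : ℕ → (Fin 8 → ℕ) → ℕ} (h : Walkable (.table r) counters c)
    (h' : Walkable (.table r) counters c') :
    Walkable (.table r) counters fun n e => c n e + c' n e :=
  h.add (by simp) (by simp [counters]) (by simp [counters]) h'

/-- The stacks of the idle variables `5, 6, 7` are kept apart, so that the loops can be nested. -/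
theorem walkable_size : Walkable (.table r) {.hi 6, .lo 6} fun n _ => n := by
  simpa using (Walkable.one (T := .table r) (by simp)).mul_size 6 (by decide)
    (by simp) (by simp) (by simp) (by simp) (by simp) (by simp) (by simp)

theorem walkable_size_sq :
    Walkable (.table r) {.hi 5, .lo 5, .hi 6, .lo 6} fun n _ => n * n := by
  simpa using (walkable_size (r := r)).mul_size 5 (by decide)
    (by simp) (by simp) (by simp) (by simp) (by simp) (by simp) (by simp)

theorem walkable_size_cube : Walkable (.table r) counters fun n _ => n * (n * n) := by
  refine ((walkable_size_sq (r := r)).mul_size 7 (by decide)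
    (by simp) (by simp) (by simp) (by simp) (by simp) (by simp) (by simp)).mono ?_
  rintro k (rfl | rfl | rfl | rfl | rfl | rfl) <;> simp [counters]


theorem walkable_var (x : Fin 8) : Walkable (.table r) counters fun _ e => e x := by
  have h := (Walkable.one (T := .table r) (by simp)).mul_var x
    (by simp) (by simp) (by simp) (by simp) (by simp) (by simp) (by simp)
  simp only [mul_one] at h
  refine h.mono ?_
  rintro k (rfl | rfl | h)
  · simp [counters]
  · simp [counters]
  · exact h.elim

theorem walkable_var_mul_size {x : Fin 8} (hx : x < 5) :
    Walkable (.table r) counters fun n e => e x * n := by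
  refine ((walkable_size (r := r)).mul_var x
    (by simp) (by simp) (by simp) (by simp; omega) (by simp) (by simp) (by simp)).mono ?_
  rintro k (rfl | rfl | rfl | rfl) <;> simp [counters]

theorem walkable_var_mul_size_sq {x : Fin 8} (hx : x < 5) :
    Walkable (.table r) counters fun n e => e x * (n * n) := by
  refine ((walkable_size_sq (r := r)).mul_var x
    (by simp) (by simp) (by simp) (by simp; omega) (by simp) (by simp) (by simp)).mono ?_
  rintro k (rfl | rfl | rfl | rfl | rfl | rfl) <;> simp [counters]

end Table

/-- According to the table `J`, the value at `(x, y)` is `z`. The length of `J` is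
arbitrary; entries beyond its end count as false. -/
def JoinBit (n : ℕ) (J : List Bool) (x y z : ℕ) : Prop :=
  J[x * (n * n) + (y * n + z)]? = some true

/-- According to the table `W`, the first (`s = false`) or second (`s = true`) set that belongs to
the pair `(x, y)` contains `z`. -/
def SetBit (s : Bool) (n : ℕ) (W : List Bool) (x y z : ℕ) : Prop :=
  W[x * (n * (n + n)) + (y * (n + n) + (cond s n 0 + z))]? = some true

theorem Decides.joinBit {d : ℕ} (x y z : Fin 8) (hx : x < 5) (hy : y < 5) :
    Decides d fun n J _ e => JoinBit n J (e x) (e y) (e z) :=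
  (Decides.of_walkable (T := .table false) (by simp)
    ((walkable_var_mul_size_sq hx).add_counters
      ((walkable_var_mul_size hy).add_counters (walkable_var z)))
    fun _ o => o == some true).congr fun n J W e => by simp [JoinBit, mem]

theorem Decides.setBit {d : ℕ} (s : Bool) (x y z : Fin 8) (hx : x < 5) (hy : y < 5) :
    Decides d fun n _ W e => SetBit s n W (e x) (e y) (e z) := by
  have h1 := (walkable_var_mul_size_sq (r := true) hx).add_counters (walkable_var_mul_size_sq hx)
  have h2 := (walkable_var_mul_size (r := true) hy).add_counters (walkable_var_mul_size hy)
  have h3 := (walkable_size (r := true)).mono (U' := counters)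
    (by rintro k (rfl | rfl) <;> simp [counters])
  cases s
  · exact (Decides.of_walkable (T := .table true) (by simp)
      (h1.add_counters (h2.add_counters (walkable_var z)))
      fun _ o => o == some true).congr fun n J W e => by simp [SetBit, mem, mul_add]
  · exact (Decides.of_walkable (T := .table true) (by simp)
      (h1.add_counters (h2.add_counters (h3.add_counters (walkable_var z))))
      fun _ o => o == some true).congr fun n J W e => by simp [SetBit, mem, mul_add]

/-- The first (`s = false`) or second (`s = true`) sets that `W` assigns to the pairs of elements
are prime, bi-closed and pairwise incombinable with respect to `J`. -/
def GoodSets (s : Bool) (n : ℕ) (J W : List Bool) : Prop :=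
  ∀ x < n, ∀ y < n, ∀ a < n, ∀ b < n, ∀ c < n,
    (JoinBit n J a b c →
      (SetBit s n W x y c ↔ SetBit s n W x y a ∨ SetBit s n W x y b)) ∧
    ¬ (JoinBit n J a b c ∧ SetBit s n W x y a ∧ SetBit s n W x y b)

/-- The table `J` describes a partial algebra of size `n`, and the table `W` a certificate. The
clauses are put in such a form that they match the closure properties of `Decides`. -/
def GoodTables (n : ℕ) (J W : List Bool) : Prop :=
  (J.length = n * (n * n) ∧ W.length = n * (n * n) + n * (n * n)) ∧
  (∀ a < n, ∀ b < n, ∀ c < n, ∀ d < n, JoinBit n J a b c ∧ JoinBit n J a b d → c = d) ∧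
  (GoodSets false n J W ∧ GoodSets true n J W) ∧
  (∀ a < n, ∀ b < n, ¬ a = b → (SetBit false n W a b a ↔ ¬ SetBit false n W a b b)) ∧
  (∀ a < n, ∀ b < n, ¬ (SetBit true n W a b a ∧ SetBit true n W a b b) →
    ¬ ∀ c < n, ¬ JoinBit n J a b c)

theorem decides_goodSets (s : Bool) : Decides 0 fun n J W _ => GoodSets s n J W := by
  have hJ : Decides 5 fun n J _ e => JoinBit n J (e 2) (e 3) (e 4) :=
    .joinBit 2 3 4 (by decide) (by decide)
  have hS : ∀ z : Fin 8, Decides 5 fun n _ W e => SetBit s n W (e 0) (e 1) (e z) :=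
    fun z => .setBit s 0 1 z (by decide) (by decide)
  have h2 := hS 2
  have h3 := hS 3
  have h4 := hS 4
  refine (Decides.all 0 (by decide) <| .all 1 (by decide) <| .all 2 (by decide) <|
    .all 3 (by decide) <| .all 4 (by decide) <|
    (hJ.imp (h4.iff (h2.or h3))).and (hJ.and (h2.and h3)).not).congr
    fun _ _ _ _ => Iff.rfl

theorem decides_goodTables : Decides 0 fun n J W _ => GoodTables n J W := by
  have hJ : ∀ z : Fin 8, Decides 4 fun n J _ e => JoinBit n J (e 0) (e 1) (e z) :=
    fun z => .joinBit 0 1 z (by decide) (by decide)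
  have hS : ∀ s, ∀ z : Fin 8, Decides 2 fun n _ W e => SetBit s n W (e 0) (e 1) (e z) :=
    fun s z => .setBit s 0 1 z (by decide) (by decide)
  have hl1 : Decides 0 fun n J _ _ => J.length = n * (n * n) :=
    .length_eq (T := .table false) (by simp) walkable_size_cube
  have hl2 : Decides 0 fun n _ W _ => W.length = n * (n * n) + n * (n * n) :=
    .length_eq (T := .table true) (by simp) (walkable_size_cube.add_counters walkable_size_cube)
  have hf := Decides.all 0 (by decide) <| .all 1 (by decide) <| .all 2 (by decide) <|
    .all 3 (by decide) <| ((hJ 2).and (hJ 3)).imp (.var_eq 2 3 (by decide))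
  have h0 := hS false 0
  have h1 := hS false 1
  have hs := Decides.all 0 (by decide) <| .all 1 (by decide) <|
    (Decides.var_eq 0 1 (by decide)).not.imp (h0.iff h1.not)
  have hc := Decides.all 0 (by decide) <| .all 1 (by decide) <|
    ((hS true 0).and (hS true 1)).not.imp
      (Decides.all 2 (by decide)
        (Decides.joinBit 0 1 2 (by decide) (by decide)).not).not
  refine ((hl1.and hl2).and <| hf.and <|
    ((decides_goodSets false).and (decides_goodSets true)).and <| hs.and hc).congr
    fun _ _ _ _ => Iff.rfl

/-! ### The verifier -/

theorem mem_zero : mem 0 [] [] 0 = fun _ => [] := by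
  funext k
  rcases k with _ | r | _ | _ | j | j
  · rfl
  · cases r <;> rfl
  all_goals rfl

/-- Read a `0` of the unary number at the beginning of the input; false if there is none. -/
def countTest : TM2.Stmt Alphabet Bool Memory :=
  .peek none (fun v o => (v.1, if o = some (.inl false) then some false else none)) <|
    .branch (fun v => v.2.isSome)
      (.pop none (fun v _ => v) <|
        .push (some (.hi 0)) (fun _ => false) <| .push (some (.hi 1)) (fun _ => false) <|
        .push (some (.hi 2)) (fun _ => false) <| .push (some (.hi 3)) (fun _ => false) <|
        .push (some (.hi 4)) (fun _ => false) <| .push (some (.hi 5)) (fun _ => false) <|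
        .push (some (.hi 6)) (fun _ => false) <| .push (some (.hi 7)) (fun _ => false) <|
        .load (fun v => (v.1, none)) <| .goto fun _ => true)
      (.goto fun _ => false)

/-- Counting fills the stacks `hi j` of all variables, which have the value `0` at the beginning. -/
theorem runs_count (n : ℕ) (h : i.head? ≠ some (.inl false)) :
    Runs (.loop countTest skip) (conf f (List.replicate n (.inl false) ++ i) (mem 0 [] [] 0))
      (conf f i (mem n [] [] 0)) (n * 2 + 1) := by
  let g : ℕ → Memory × ∀ k, List (Alphabet k) := fun x =>
    conf f (List.replicate (n - x) (.inl false) ++ i) (mem x [] [] 0)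
  have hloop := Runs.loop (t := 1) (test := countTest) (p := skip) (s' := conf f i (mem n [] [] 0))
    n g (fun x => g (x + 1)) ?_ (fun _ _ => runs_skip) ?_
  · simpa [g] using hloop
  · intro x hx
    obtain ⟨y, hy⟩ : ∃ y, n - x = y + 1 := ⟨n - x - 1, by omega⟩
    have hy' : n - (x + 1) = y := by omega
    simp only [g, hy, hy', Steps, conf, countTest, List.replicate_succ]
    simp
    congr 1
    funext k
    rcases k with _ | r | _ | _ | j | j
    · rfl
    · cases r <;> rfl
    · rfl
    · rfl
    · simp [mem]
    · fin_cases j <;> simp [mem, List.replicate_succ]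
  · simp [g, Steps, conf, countTest, h]

/-- Mark a symbol as belonging to the first or to the second input string. -/
def mark : Bool → Bool → Bool ⊕ Bool
  | false => .inl
  | true => .inr

/-- The symbol, if it is marked as belonging to the given input string. -/
def unmark : Bool → Bool ⊕ Bool → Option Bool
  | false => Sum.getLeft?
  | true => Sum.getRight?

theorem unmark_mark (s b : Bool) : unmark s (mark s b) = some b := by
  cases s <;> rfl

/-- Move a symbol of the given input string to the auxiliary stack; false if there is none. -/
def loadTest (s : Bool) : TM2.Stmt Alphabet Bool Memory :=
  .peek none (fun v o => (v.1, o.bind (unmark s))) <| .branch (fun v => v.2.isSome)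
    (.pop none (fun v _ => v) <| .push (some .aux) (fun v => v.2.getD false) <|
      .load (fun v => (v.1, none)) <| .goto fun _ => true)
    (.goto fun _ => false)

/-- Loading reverses a table twice, via the auxiliary stack. -/
theorem runs_load (s : Bool) (L : List Bool) (h : i.head?.bind (unmark s) = none)
    (hm : m .aux = []) :
    Runs (.seq (.loop (loadTest s) skip) (moveAll .aux (.table s)))
      (conf f (L.map (mark s) ++ i) m) (conf f i (update m (.table s) (L ++ m (.table s))))
      (L.length * 4 + 2) := by
  let g : ℕ → Memory × ∀ k, List (Alphabet k) := fun x =>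
    conf f ((L.drop x).map (mark s) ++ i) (update m .aux (L.take x).reverse)
  have hloop := Runs.loop (t := 1) (test := loadTest s) (p := skip)
    (s' := conf f i (update m .aux L.reverse))
    L.length g (fun x => g (x + 1)) ?_ (fun _ _ => runs_skip) ?_
  · refine (hloop.seq (runs_moveAll (by simp))).congr ?_ ?_ ?_
    · have h0 : update m .aux [] = m := by rw [← hm, update_eq_self]
      simp [g, h0]
    · congr 1
      funext k
      rcases eq_or_ne k (.table s) with rfl | h1
      · simp
      rcases eq_or_ne k .aux with rfl | h2
      · simp [hm]
      · simp [h1, h2]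
    · simp
      omega
  · intro x hx
    have e : (L.take (x + 1)).reverse = L[x] :: (L.take x).reverse := by
      rw [List.take_succ_eq_append_getElem hx, List.reverse_append]
      rfl
    have e' : (L.drop x).map (mark s) = mark s L[x] :: (L.drop (x + 1)).map (mark s) := by
      rw [List.drop_eq_getElem_cons hx]
      rfl
    simp only [g, Steps, conf, loadTest, e, e']
    simp [unmark_mark, -List.map_drop]
  · simp [g, Steps, conf, loadTest, h, -List.map_drop]

/-- Erase stacks. -/
def clear : List (Option Key) → Prog Alphabet Memory
  | [] => skip
  | k :: ks =>
    .seq (.loop (.pop k (fun v o => (v.1, if o.isSome then some false else none)) <|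
      .branch (fun v => v.2.isSome) (.load (fun v => (v.1, none)) <| .goto fun _ => true)
        (.goto fun _ => false)) skip) (clear ks)

theorem runs_clear (ks : List (Option Key)) (N : ℕ) (S : ∀ k, List (Alphabet k))
    (hS : ∀ k, (S k).length ≤ N) :
    Runs (clear ks) ((f, none), S) ((f, none), fun k => if k ∈ ks then [] else S k)
      (ks.length * (N * 2 + 1) + 1) := by
  induction ks generalizing S with
  | nil => simpa [clear] using runs_skip
  | cons k ks ih =>
    let g : ℕ → Memory × ∀ k, List (Alphabet k) := fun x =>
      ((f, none), update S k ((S k).drop x))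
    have hloop := Runs.loop (t := 1) (p := skip)
      (test := .pop k (fun v o => (v.1, if o.isSome then some false else none)) <|
      .branch (fun v => v.2.isSome) (.load (fun v => (v.1, none)) <| .goto fun _ => true)
        (.goto fun _ => false)) (s' := ((f, none), update S k []))
      (S k).length g (fun x => g (x + 1)) ?_ (fun _ _ => runs_skip) ?_
    · refine (hloop.seq (ih (update S k []) fun k' => ?_)).congr ?_ ?_ ?_
      · rcases eq_or_ne k' k with rfl | h
        · simp
        · simpa [h] using hS k'
      · simp [g, update_eq_self]
      · congr 1
        funext k'
        rcases eq_or_ne k' k with rfl | h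
        · simp
        · simp [h]
      · have := hS k
        simp only [List.length_cons]
        linarith
    · intro x hx
      obtain ⟨b, e⟩ : ∃ b, (S k).drop x = b :: (S k).drop (x + 1) :=
        ⟨_, List.drop_eq_getElem_cons hx⟩
      simp [g, Steps, e]
    · simp [g, Steps]

/-- The verifier: read the size of the domain and the two tables, decide with the program `p`
whether the tables are good, erase all stacks and write the result. -/
noncomputable def verifier (p : Prog Alphabet Memory) : Prog Alphabet Memory :=
  .seq (.loop countTest skip) <|
  .seq (.basic (.pop none (fun v o => (decide (o = some (.inl true)), v.2)) <|
    .goto fun _ => ())) <|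
  .seq (.cond (.goto fun v => v.1)
    (.seq (.seq (.loop (loadTest false) skip) (moveAll .aux (.table false))) <|
      .seq (.seq (.loop (loadTest true) skip) (moveAll .aux (.table true))) p) skip) <|
  .seq (clear Finset.univ.toList)
    (.basic (.push (some .output) (fun v => v.1) <| .load (fun _ => (false, none)) <|
      .goto fun _ => ()))

/-- The time bound of the verifier, given that of the program `p`. -/
noncomputable def verifierTime (q : Polynomial ℕ) : Polynomial ℕ :=
  (Polynomial.X * 2 + 1) + (1 + ((((Polynomial.X * 4 + 2) + ((Polynomial.X * 4 + 2) + q)) + 1) +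
    ((((Finset.univ : Finset (Option Key)).toList.length : Polynomial ℕ) *
      (Polynomial.X * 2 + 1) + 1) + 1)))

/-- The last part of the verifier, from an arbitrary situation with short stacks. -/
theorem runs_finish (N : ℕ) (hi : i.length ≤ N) (hm : ∀ k, (m k).length ≤ N) :
    Runs (.seq (clear Finset.univ.toList)
      (.basic (.push (some .output) (fun v => v.1) <| .load (fun _ => (false, none)) <|
        .goto fun _ => ()))) (conf f i m) (conf false [] (update (fun _ => []) .output [f]))
      ((Finset.univ : Finset (Option Key)).toList.length * (N * 2 + 1) + 1 + 1) := by
  refine (runs_clear _ N (allStacks i m) ?_).seq (Runs.basic ?_)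
  · rintro (_ | k)
    · exact hi
    · exact hm k
  · have : (fun k => if k ∈ (Finset.univ : Finset (Option Key)).toList then [] else
        allStacks i m k) = allStacks [] fun _ => [] := by
      funext k
      cases k <;> simp
    rw [this]
    simp [Steps, conf]

theorem admissible_zero (n : ℕ) : Admissible n 0 := ⟨fun _ => Nat.zero_le _, fun _ _ => rfl⟩

open Classical in
/-- Every bit string has one of the two forms that are distinguished here. A string of zeros does
not encode a partial algebra and is rejected. -/
theorem exists_verifier : ∃ (p : Prog Alphabet Memory) (q : Polynomial ℕ),
    (∀ (n : ℕ) (J W : List Bool), Runs p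
      (conf false ((List.replicate n false ++ true :: J).map .inl ++ W.map .inr) fun _ => [])
      (conf false [] (update (fun _ => []) .output [decide (GoodTables n J W)]))
      (q.eval (n + 1 + J.length + W.length))) ∧
    ∀ (n : ℕ) (W : List Bool), Runs p
      (conf false ((List.replicate n false).map .inl ++ W.map .inr) fun _ => [])
      (conf false [] (update (fun _ => []) .output [false])) (q.eval (n + W.length)) := by
  obtain ⟨p, q, hp⟩ := decides_goodTables
  refine ⟨verifier p, verifierTime q, fun n J W => ?_, fun n W => ?_⟩
  · set N := n + 1 + J.length + W.length with hN
    simp only [verifierTime, Polynomial.eval_add, Polynomial.eval_mul, Polynomial.eval_X,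
      Polynomial.eval_one, Polynomial.eval_ofNat, Polynomial.eval_natCast]
    have h1 := runs_count (f := false) (i := .inl true :: (J.map .inl ++ W.map .inr)) n (by simp)
    have h2 := runs_load (f := true) (i := W.map .inr) (m := mem n [] [] 0) false J
      (by cases W <;> rfl) rfl
    have h3 := runs_load (f := true) (i := [])
      (m := update (mem n [] [] 0) (.table false) (J ++ mem n [] [] 0 (.table false)))
      true W rfl rfl
    have h4 := hp n J W 0 (admissible_zero n) (fun _ _ => rfl) true
    have h5 := runs_finish (f := decide (GoodTables n J W)) (i := []) (m := mem n J W 0) N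
      (Nat.zero_le _) (fun k => (length_mem_le (admissible_zero n) k).trans (by omega))
    have e : update (update (mem n [] [] 0) (.table false) (J ++ mem n [] [] 0 (.table false)))
        (.table true) (W ++ update (mem n [] [] 0) (.table false)
          (J ++ mem n [] [] 0 (.table false)) (.table true)) = mem n J W 0 := by
      funext k
      rcases k with _ | r | _ | _ | j | j
      · rfl
      · cases r <;> simp [mem]
      all_goals simp [mem]
    rw [e, List.append_nil] at h3
    rw [mem_zero] at h1
    refine Runs.seq ((h1.congr ?_ rfl ?_)) (Runs.seq (Runs.basic ?_) (Runs.seq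
      ((Runs.cond_true steps_flag (h2.seq (h3.seq h4))).mono ?_) h5))
    · simp
    · omega
    · simp [Steps, conf]
      rfl
    · have := eval_le_eval q (show n + J.length + W.length ≤ N by omega)
      omega
  · set N := n + W.length with hN
    simp only [verifierTime, Polynomial.eval_add, Polynomial.eval_mul, Polynomial.eval_X,
      Polynomial.eval_one, Polynomial.eval_ofNat, Polynomial.eval_natCast]
    have h1 := runs_count (f := false) (i := W.map .inr) n (by cases W <;> simp)
    have h5 := runs_finish (f := false) (i := (W.map .inr).tail) (m := mem n [] [] 0) N
      (by simp; omega) (fun k => (length_mem_le (admissible_zero n) k).trans (by simp; omega))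
    rw [mem_zero] at h1
    refine Runs.seq ((h1.congr ?_ rfl ?_)) (Runs.seq (s' := conf false (W.map .inr).tail _)
      (Runs.basic ?_) (Runs.seq ((Runs.cond_false steps_flag runs_skip).mono ?_) h5))
    · simp
    · omega
    · cases W <;> simp [Steps, conf]
    · omega

open Classical in
theorem polyTimeDecidable_of_goodTables {R : List Bool → List Bool → Prop}
    (h : ∀ n J W, R (List.replicate n false ++ true :: J) W ↔ GoodTables n J W)
    (h' : ∀ n W, ¬ R (List.replicate n false) W) : PolyTimeDecidable R := by
  obtain ⟨p, q, hp, hp'⟩ := exists_verifier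
  refine ⟨fun x => decide (R x.1 x.2), by simp, ⟨?_⟩⟩
  refine
    { tm := p.machine none (some .output) (false, none)
      inputAlphabet := Equiv.refl _
      outputAlphabet := Equiv.refl _
      time := q + 1
      outputsFun := fun a => Classical.choice ?_ }
  obtain ⟨x, W⟩ := a
  have key : Runs p (conf false (x.map .inl ++ W.map .inr) fun _ => [])
      (conf false [] (update (fun _ => []) .output [decide (R x W)]))
      (q.eval (x.length + W.length)) := by
    have hx : ∃ n, x = List.replicate n false ∨ ∃ J, x = List.replicate n false ++ true :: J := by
      induction x with
      | nil => exact ⟨0, .inl rfl⟩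
      | cons b x ih =>
        cases b with
        | true => exact ⟨0, .inr ⟨x, rfl⟩⟩
        | false =>
          obtain ⟨n, rfl | ⟨J, rfl⟩⟩ := ih
          · exact ⟨n + 1, .inl rfl⟩
          · exact ⟨n + 1, .inr ⟨J, rfl⟩⟩
    obtain ⟨n, rfl | ⟨J, rfl⟩⟩ := hx
    · simpa [h'] using hp' n W
    · simpa [h, add_assoc, add_comm 1] using hp n J W
  obtain ⟨t, ht, e⟩ := key.machine (k₀ := none) (k₁ := some .output)
  have hlen : ((Computability.encodingProd (Computability.encodingList Bool)
      (Computability.encodingList Bool)).encode (x, W)).length = x.length + W.length := by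
    simp [Computability.encodingProd, Computability.encodingList]
  refine ⟨⟨⟨t, ?_⟩, ?_⟩⟩
  · have h1 : initList (p.machine none (some .output) (false, none)) (List.map (Equiv.refl _).invFun
        ((Computability.encodingProd (Computability.encodingList Bool)
          (Computability.encodingList Bool)).encode (x, W))) =
        ⟨some (some p.entry), (false, none), allStacks (x.map .inl ++ W.map .inr) fun _ => []⟩ := by
      simp only [initList]
      congr 1
      funext k
      cases k with
      | none => simp [Computability.encodingProd, Computability.encodingList]; rfl
      | some k => rfl
    have h2 : haltList (p.machine none (some .output) (false, none)) (List.map (Equiv.refl _).invFun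
        (Computability.encodeBool (decide (R x W)))) =
        ⟨none, (false, none), allStacks [] (update (fun _ => []) .output [decide (R x W)])⟩ := by
      simp only [haltList]
      congr 1
      funext k
      cases k with
      | none => rfl
      | some k =>
        cases k <;> rfl
    exact (congrArg (fun c => (flip bind _)^[t] (some c)) h1).trans
      (e.trans (congrArg some h2.symm))
  · rw [hlen, Polynomial.eval_add, Polynomial.eval_one]
    exact ht

/-! ### Representations and certificates -/

section Representation

variable {A X : Type} {𝒜 : PartialAlgebra A}

/-- A set of the kind that a certificate consists of. -/
structure IsPoint (𝒜 : PartialAlgebra A) (U : Set A) : Prop where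
  prime : IsJoinPrime 𝒜 U
  biClosed : IsBiClosed 𝒜 U
  incombinable : IsPairwiseIncombinable 𝒜 U

theorem isPoint_empty (𝒜 : PartialAlgebra A) : IsPoint 𝒜 ∅ :=
  ⟨fun _ _ _ _ h => h.elim, fun _ _ _ _ h => h.elim id id, fun _ _ h => h.elim⟩

theorem IsIso.join_eq_some {𝒟 : DisjointUnionAlgebraOfSets X} {θ : A → 𝒟.sets}
    (h : IsIso 𝒜 𝒟.toPartialAlgebra θ) {a b c : A} (hc : 𝒜.join a b = some c) :
    Disjoint (θ a).1 (θ b).1 ∧ (θ c).1 = (θ a).1 ∪ (θ b).1 := by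
  have := h.1 a b
  simp only [DisjointUnionAlgebraOfSets.toPartialAlgebra, hc, Option.map_some] at this
  split_ifs at this with hd
  exact ⟨hd, (congrArg Subtype.val (Option.some.inj this)).symm⟩

theorem IsIso.join_eq_none {𝒟 : DisjointUnionAlgebraOfSets X} {θ : A → 𝒟.sets}
    (h : IsIso 𝒜 𝒟.toPartialAlgebra θ) {a b : A} :
    𝒜.join a b = none ↔ ¬ Disjoint (θ a).1 (θ b).1 := by
  have := h.1 a b
  simp only [DisjointUnionAlgebraOfSets.toPartialAlgebra] at this
  split_ifs at this with hd
  · cases hj : 𝒜.join a b <;> simp_all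
  · cases hj : 𝒜.join a b <;> simp_all

/-- The elements whose sets contain a given point of the base of a representation. -/
theorem IsIso.isPoint {𝒟 : DisjointUnionAlgebraOfSets X} {θ : A → 𝒟.sets}
    (h : IsIso 𝒜 𝒟.toPartialAlgebra θ) (x : X) : IsPoint 𝒜 {a | x ∈ (θ a).1} where
  prime a b c hc hx := by
    rw [Set.mem_ofPred_eq, (h.join_eq_some hc).2] at hx
    exact hx
  biClosed a b c hc hx := by
    rw [Set.mem_ofPred_eq, (h.join_eq_some hc).2]
    exact hx
  incombinable a b ha hb := h.join_eq_none.2 (Set.not_disjoint_iff.2 ⟨x, ha, hb⟩)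

/-- A family of sets as in a certificate is the base of a representation. -/
theorem hasDisjointUnionRepresentation_of_isPoint (U : X → Set A) (hU : ∀ x, IsPoint 𝒜 (U x))
    (hsep : ∀ a b, a ≠ b → ∃ x, Xor (a ∈ U x) (b ∈ U x))
    (hcov : ∀ a b, 𝒜.join a b = none → ∃ x, a ∈ U x ∧ b ∈ U x) :
    HasDisjointUnionRepresentation 𝒜 := by
  let θ : A → Set X := fun a => {x | a ∈ U x}
  have hsome : ∀ {a b c}, 𝒜.join a b = some c → Disjoint (θ a) (θ b) ∧ θ a ∪ θ b = θ c := by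
    intro a b c hc
    refine ⟨Set.disjoint_left.2 fun x ha hb => ?_, Set.ext fun x => ?_⟩
    · simp [(hU x).incombinable a b ha hb] at hc
    · exact ⟨(hU x).biClosed a b c hc, (hU x).prime a b c hc⟩
  have hnone : ∀ {a b}, 𝒜.join a b = none → ¬ Disjoint (θ a) (θ b) := fun h =>
    Set.not_disjoint_iff.2 (hcov _ _ h)
  let 𝒟 : DisjointUnionAlgebraOfSets X := {
    sets := Set.range θ
    union_mem := by
      rintro _ ⟨a, rfl⟩ _ ⟨b, rfl⟩ hd
      cases hj : 𝒜.join a b with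
      | none => exact (hnone hj hd).elim
      | some c => exact ⟨c, (hsome hj).2.symm⟩ }
  refine ⟨X, 𝒟, fun a => ⟨θ a, a, rfl⟩, fun a b => ?_, fun a b hab => ?_, ?_⟩
  · simp only [DisjointUnionAlgebraOfSets.toPartialAlgebra]
    cases hj : 𝒜.join a b with
    | none => simp [hnone hj]
    | some c => simp [(hsome hj).1, (hsome hj).2]
  · by_contra hne
    obtain ⟨x, hx⟩ := hsep a b hne
    have h : x ∈ θ a ↔ x ∈ θ b := iff_of_eq (congrArg (x ∈ ·) (congrArg Subtype.val hab))
    simp only [θ, Set.mem_ofPred_eq] at h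
    simp [h] at hx
  · rintro ⟨_, a, rfl⟩
    exact ⟨a, rfl⟩

theorem hasDisjointUnionRepresentation_iff_exists_certifies {n : ℕ} (𝒜 : PartialAlgebra (Fin n)) :
    HasDisjointUnionRepresentation 𝒜 ↔ ∃ C : SetFamily n, C.Certifies 𝒜 := by
  classical
  constructor
  · rintro ⟨X, 𝒟, θ, h⟩
    have hS : ∀ a b : Fin n, ∃ S : Finset (Fin n), IsPoint 𝒜 (S : Set (Fin n)) ∧
        (a ≠ b → Xor (a ∈ S) (b ∈ S)) := by
      intro a b
      by_cases hab : a = b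
      · exact ⟨∅, by simpa using isPoint_empty 𝒜, fun h => (h hab).elim⟩
      · have hne : ∃ x, Xor (x ∈ (θ a).1) (x ∈ (θ b).1) := by
          by_contra! hx
          refine hab (h.2.1 (Subtype.ext (Set.ext fun x => ?_)))
          have := hx x
          rwa [xor_iff_not_iff, not_not] at this
        obtain ⟨x, hx⟩ := hne
        exact ⟨Finset.univ.filter fun c => x ∈ (θ c).1, by simpa using h.isPoint x,
          fun _ => by simpa using hx⟩
    have hT : ∀ a b : Fin n, ∃ T : Finset (Fin n), IsPoint 𝒜 (T : Set (Fin n)) ∧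
        (𝒜.join a b = none → a ∈ T ∧ b ∈ T) := by
      intro a b
      by_cases hab : 𝒜.join a b = none
      · obtain ⟨x, hx⟩ := Set.not_disjoint_iff.1 (h.join_eq_none.1 hab)
        exact ⟨Finset.univ.filter fun c => x ∈ (θ c).1, by simpa using h.isPoint x,
          fun _ => by simpa using hx⟩
      · exact ⟨∅, by simpa using isPoint_empty 𝒜, fun h => (hab h).elim⟩
    choose S hS hS' using hS
    choose T hT hT' using hT
    exact ⟨⟨S, T⟩, fun a b => (hS a b).prime, fun a b => (hS a b).biClosed,
      fun a b => (hS a b).incombinable, fun a b => (hT a b).prime, fun a b => (hT a b).biClosed,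
      fun a b => (hT a b).incombinable, hS', hT'⟩
  · rintro ⟨C, h⟩
    refine hasDisjointUnionRepresentation_of_isPoint (X := Bool × Fin n × Fin n)
      (fun x => (cond x.1 (C.T x.2.1 x.2.2) (C.S x.2.1 x.2.2) : Finset (Fin n)))
      ?_ (fun a b hab => ⟨(false, a, b), h.separates a b hab⟩)
      fun a b hab => ⟨(true, a, b), h.covers a b hab⟩
    rintro ⟨_ | _, a, b⟩
    · exact ⟨h.prime_S a b, h.biClosed_S a b, h.incombinable_S a b⟩
    · exact ⟨h.prime_T a b, h.biClosed_T a b, h.incombinable_T a b⟩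

end Representation

/-! ### The tables as bit strings -/

theorem length_flatMap_finRange {n m : ℕ} (f : Fin n → List Bool) (hf : ∀ a, (f a).length = m) :
    ((List.finRange n).flatMap f).length = n * m := by
  simp [List.length_flatMap, hf]

/-- Entry `r` of block `a` of a concatenation of blocks of equal length. -/
theorem getElem?_flatMap_finRange {n m : ℕ} (f : Fin n → List Bool) (hf : ∀ a, (f a).length = m)
    (a : Fin n) {r : ℕ} (hr : r < m) :
    ((List.finRange n).flatMap f)[a * m + r]? = (f a)[r]? := by
  induction n with
  | zero => exact a.elim0
  | succ n ih =>
    rw [List.finRange_succ, List.flatMap_cons, List.flatMap_map]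
    refine a.cases ?_ fun a => ?_
    · simp [List.getElem?_append_left, hf, hr]
    · rw [List.getElem?_append_right (by rw [hf, Fin.val_succ]; nlinarith), hf,
        ← ih (fun a => f a.succ) (fun a => hf _) a]
      congr 1
      rw [Fin.val_succ, add_mul, one_mul]
      omega

theorem getElem?_map_finRange {n : ℕ} (f : Fin n → Bool) (a : Fin n) :
    ((List.finRange n).map f)[(a : ℕ)]? = some (f a) := by
  simp

/-- The table of the operation. -/
def PartialAlgebra.table {n : ℕ} (𝒜 : PartialAlgebra (Fin n)) : List Bool :=
  (List.finRange n).flatMap fun a => (List.finRange n).flatMap fun b =>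
    (List.finRange n).map fun c => decide (𝒜.join a b = some c)

theorem PartialAlgebra.encode_eq {n : ℕ} (𝒜 : PartialAlgebra (Fin n)) :
    𝒜.encode = List.replicate n false ++ true :: 𝒜.table := rfl

theorem PartialAlgebra.length_table {n : ℕ} (𝒜 : PartialAlgebra (Fin n)) :
    𝒜.table.length = n * (n * n) :=
  length_flatMap_finRange _ fun _ => length_flatMap_finRange _ fun _ => by simp

theorem SetFamily.length_encode {n : ℕ} (C : SetFamily n) :
    C.encode.length = n * (n * (n + n)) :=
  length_flatMap_finRange _ fun _ => length_flatMap_finRange _ fun _ => by simp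

theorem add_lt_mul {n m b r : ℕ} (hb : b < n) (hr : r < m) : b * m + r < n * m := by
  calc b * m + r < b * m + m := by omega
    _ = (b + 1) * m := by ring
    _ ≤ n * m := Nat.mul_le_mul_right _ hb

theorem PartialAlgebra.joinBit_table {n : ℕ} (𝒜 : PartialAlgebra (Fin n)) (a b c : Fin n) :
    JoinBit n 𝒜.table a b c ↔ 𝒜.join a b = some c := by
  rw [JoinBit, PartialAlgebra.table,
    getElem?_flatMap_finRange _ (fun _ => length_flatMap_finRange _ fun _ => by simp) a
      (add_lt_mul b.2 c.2),
    getElem?_flatMap_finRange _ (fun _ => by simp) b c.2, getElem?_map_finRange]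
  simp

theorem SetFamily.setBit_encode {n : ℕ} (C : SetFamily n) (s : Bool) (a b c : Fin n) :
    SetBit s n C.encode a b c ↔ c ∈ cond s (C.T a b) (C.S a b) := by
  have h : cond s n 0 + (c : ℕ) < n + n := by
    cases s <;> simp only [cond_true, cond_false] <;> omega
  rw [SetBit, SetFamily.encode,
    getElem?_flatMap_finRange _ (fun _ => length_flatMap_finRange _ fun _ => by simp) a
      (add_lt_mul b.2 h),
    getElem?_flatMap_finRange _ (fun _ => by simp) b h]
  cases s
  · rw [cond_false, zero_add, List.getElem?_append_left (by simp), getElem?_map_finRange]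
    simp
  · rw [cond_true, List.getElem?_append_right (by simp), List.length_map, List.length_finRange,
      Nat.add_sub_cancel_left, getElem?_map_finRange]
    simp

theorem ext_bits {n m : ℕ} {L L' : List Bool} (hL : L.length = n * m) (hL' : L'.length = n * m)
    (h : ∀ a < n, ∀ r < m, L[a * m + r]? = some true ↔ L'[a * m + r]? = some true) : L = L' := by
  refine List.ext_getElem (hL.trans hL'.symm) fun i hi hi' => ?_
  have hm : 0 < m := Nat.pos_of_ne_zero (by rintro rfl; omega)
  have := h (i / m) (Nat.div_lt_of_lt_mul (by rwa [hL, mul_comm] at hi)) (i % m) (Nat.mod_lt _ hm)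
  rw [mul_comm, Nat.div_add_mod, List.getElem?_eq_getElem hi, List.getElem?_eq_getElem hi',
    Option.some_inj, Option.some_inj] at this
  exact Bool.eq_iff_iff.2 this

theorem exists_eq_mul_add {n m i : ℕ} (h : i < n * m) : ∃ a < n, ∃ r < m, i = a * m + r := by
  have hm : 0 < m := Nat.pos_of_ne_zero (by rintro rfl; omega)
  exact ⟨i / m, Nat.div_lt_of_lt_mul (by rwa [mul_comm]), i % m, Nat.mod_lt _ hm, by
    rw [mul_comm, Nat.div_add_mod]⟩

theorem ext_joinBit {n : ℕ} {J J' : List Bool} (hJ : J.length = n * (n * n))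
    (hJ' : J'.length = n * (n * n))
    (h : ∀ a b c : Fin n, JoinBit n J a b c ↔ JoinBit n J' a b c) : J = J' := by
  refine ext_bits hJ hJ' fun a ha r hr => ?_
  obtain ⟨b, hb, c, hc, rfl⟩ := exists_eq_mul_add hr
  exact h ⟨a, ha⟩ ⟨b, hb⟩ ⟨c, hc⟩

theorem ext_setBit {n : ℕ} {W W' : List Bool} (hW : W.length = n * (n * (n + n)))
    (hW' : W'.length = n * (n * (n + n)))
    (h : ∀ s, ∀ a b c : Fin n, SetBit s n W a b c ↔ SetBit s n W' a b c) : W = W' := by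
  refine ext_bits hW hW' fun a ha r hr => ?_
  obtain ⟨b, hb, c, hc, rfl⟩ := exists_eq_mul_add hr
  by_cases hcn : c < n
  · simpa [SetBit] using h false ⟨a, ha⟩ ⟨b, hb⟩ ⟨c, hcn⟩
  · simpa [SetBit, Nat.add_sub_cancel' (not_lt.1 hcn)] using
      h true ⟨a, ha⟩ ⟨b, hb⟩ ⟨c - n, by omega⟩

theorem goodSets_iff {n : ℕ} (𝒜 : PartialAlgebra (Fin n)) (C : SetFamily n) (s : Bool) :
    GoodSets s n 𝒜.table C.encode ↔
      ∀ x y, IsPoint 𝒜 ((cond s (C.T x y) (C.S x y) : Finset (Fin n)) : Set (Fin n)) := by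
  constructor
  · intro h x y
    have key := fun a b c : Fin n => h x x.2 y y.2 a a.2 b b.2 c c.2
    simp only [𝒜.joinBit_table, C.setBit_encode] at key
    refine ⟨fun a b c hj => ((key a b c).1 hj).1, fun a b c hj => ((key a b c).1 hj).2,
      fun a b ha hb => ?_⟩
    cases hj : 𝒜.join a b with
    | none => rfl
    | some c => exact ((key a b c).2 ⟨hj, ha, hb⟩).elim
  · intro h x hx y hy a ha b hb c hc
    lift x to Fin n using hx
    lift y to Fin n using hy
    lift a to Fin n using ha
    lift b to Fin n using hb
    lift c to Fin n using hc
    simp only [𝒜.joinBit_table, C.setBit_encode]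
    refine ⟨fun hj => ⟨(h x y).prime a b c hj, (h x y).biClosed a b c hj⟩, fun ⟨hj, ha, hb⟩ => ?_⟩
    simp [(h x y).incombinable a b ha hb] at hj

/-- On tables that do come from a partial algebra and a family of sets, `GoodTables` expresses the
conditions on a certificate; the clause on `c = d` holds automatically. -/
theorem goodTables_iff_certifies {n : ℕ} (𝒜 : PartialAlgebra (Fin n)) (C : SetFamily n) :
    GoodTables n 𝒜.table C.encode ↔ C.Certifies 𝒜 := by
  rw [GoodTables, goodSets_iff, goodSets_iff]
  constructor
  · rintro ⟨-, -, ⟨hS, hT⟩, hs, hc⟩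
    refine ⟨fun a b => (hS a b).prime, fun a b => (hS a b).biClosed,
      fun a b => (hS a b).incombinable, fun a b => (hT a b).prime, fun a b => (hT a b).biClosed,
      fun a b => (hT a b).incombinable, fun a b hab => ?_, fun a b hab => ?_⟩
    · have := hs a a.2 b b.2 fun h => hab (Fin.ext h)
      rw [C.setBit_encode, C.setBit_encode] at this
      exact xor_iff_iff_not.2 this
    · have := hc a a.2 b b.2
      rw [C.setBit_encode, C.setBit_encode] at this
      by_contra h
      refine this h fun c hcn hj => ?_
      rw [𝒜.joinBit_table a b ⟨c, hcn⟩, hab] at hj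
      cases hj
  · intro h
    refine ⟨⟨𝒜.length_table, C.length_encode.trans (by ring)⟩, fun a ha b hb c hc d hd => ?_,
      ⟨fun a b => ⟨h.prime_S a b, h.biClosed_S a b, h.incombinable_S a b⟩,
        fun a b => ⟨h.prime_T a b, h.biClosed_T a b, h.incombinable_T a b⟩⟩,
      fun a ha b hb hab => ?_, fun a ha b hb => ?_⟩
    · rw [𝒜.joinBit_table ⟨a, ha⟩ ⟨b, hb⟩ ⟨c, hc⟩, 𝒜.joinBit_table ⟨a, ha⟩ ⟨b, hb⟩ ⟨d, hd⟩]
      rintro ⟨h1, h2⟩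
      simpa using h1.symm.trans h2
    · rw [C.setBit_encode false ⟨a, ha⟩ ⟨b, hb⟩ ⟨a, ha⟩,
        C.setBit_encode false ⟨a, ha⟩ ⟨b, hb⟩ ⟨b, hb⟩]
      exact xor_iff_iff_not.1 (h.separates ⟨a, ha⟩ ⟨b, hb⟩ fun e => hab (Fin.val_eq_of_eq e))
    · rw [C.setBit_encode true ⟨a, ha⟩ ⟨b, hb⟩ ⟨a, ha⟩,
        C.setBit_encode true ⟨a, ha⟩ ⟨b, hb⟩ ⟨b, hb⟩]
      intro hT hj
      refine hT (h.covers ⟨a, ha⟩ ⟨b, hb⟩ ?_)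
      cases hc : 𝒜.join ⟨a, ha⟩ ⟨b, hb⟩ with
      | none => rfl
      | some c => exact (hj c c.2 ((𝒜.joinBit_table ⟨a, ha⟩ ⟨b, hb⟩ c).2 hc)).elim

/-- The partial algebra and the certificate can be read off from good tables. -/
theorem goodTables_iff {n : ℕ} {J W : List Bool} :
    GoodTables n J W ↔ ∃ (𝒜 : PartialAlgebra (Fin n)) (C : SetFamily n),
      J = 𝒜.table ∧ W = C.encode ∧ C.Certifies 𝒜 := by
  classical
  constructor
  · intro h
    obtain ⟨⟨hJ, hW⟩, hf, -⟩ := id h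
    let 𝒜 : PartialAlgebra (Fin n) :=
      ⟨fun a b => if h : ∃ c : Fin n, JoinBit n J a b c then some h.choose else none⟩
    let C : SetFamily n := ⟨fun a b => Finset.univ.filter fun c => SetBit false n W a b c,
      fun a b => Finset.univ.filter fun c => SetBit true n W a b c⟩
    have h1 : J = 𝒜.table := by
      refine ext_joinBit hJ 𝒜.length_table fun a b c => ?_
      rw [𝒜.joinBit_table]
      simp only [𝒜]
      split_ifs with hc
      · rw [Option.some_inj]
        refine ⟨fun h => Fin.ext ?_, fun h => h ▸ hc.choose_spec⟩
        exact hf a a.2 b b.2 _ hc.choose.2 c c.2 ⟨hc.choose_spec, h⟩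
      · simpa using fun h => hc ⟨c, h⟩
    have h2 : W = C.encode := by
      refine ext_setBit (hW.trans (by ring)) C.length_encode fun s a b c => ?_
      rw [C.setBit_encode]
      cases s <;> simp [C]
    refine ⟨𝒜, C, h1, h2, ?_⟩
    rwa [h1, h2, goodTables_iff_certifies] at h
  · rintro ⟨𝒜, C, rfl, rfl, h⟩
    exact (goodTables_iff_certifies 𝒜 C).2 h

/-- The unary number at the beginning of a string is determined by the string. -/
theorem replicate_append_inj {n n' : ℕ} {J J' : List Bool}
    (h : List.replicate n false ++ true :: J = List.replicate n' false ++ true :: J') :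
    n = n' ∧ J = J' := by
  induction n generalizing n' with
  | zero => cases n' <;> simp_all [List.replicate_succ]
  | succ n ih =>
    cases n' with
    | zero => simp [List.replicate_succ] at h
    | succ n' => simpa using ih (by simpa [List.replicate_succ] using h)

theorem certificateRelation_iff (n : ℕ) (J W : List Bool) :
    CertificateRelation (List.replicate n false ++ true :: J) W ↔ GoodTables n J W := by
  rw [goodTables_iff]
  constructor
  · rintro ⟨n', 𝒜, C, h, rfl, hC⟩
    obtain ⟨rfl, rfl⟩ := replicate_append_inj (h.trans 𝒜.encode_eq)
    exact ⟨𝒜, C, rfl, rfl, hC⟩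
  · rintro ⟨𝒜, C, rfl, rfl, hC⟩
    exact ⟨n, 𝒜, C, rfl, rfl, hC⟩

theorem polyTimeDecidable_certificateRelation : PolyTimeDecidable CertificateRelation := by
  refine polyTimeDecidable_of_goodTables certificateRelation_iff ?_
  rintro n W ⟨n', 𝒜, C, h, -⟩
  have : true ∈ List.replicate n false := by simp [h, 𝒜.encode_eq]
  simp at this

theorem isPolyTimeVerifier_certificateRelation :
    IsPolyTimeVerifier CertificateRelation RepresentabilityProblem := by
  refine ⟨polyTimeDecidable_certificateRelation, 2 * Polynomial.X, fun x => ⟨?_, ?_⟩⟩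
  · rintro ⟨n, 𝒜, rfl, h⟩
    obtain ⟨C, hC⟩ := (hasDisjointUnionRepresentation_iff_exists_certifies 𝒜).1 h
    refine ⟨C.encode, ?_, n, 𝒜, C, rfl, rfl, hC⟩
    simp only [C.length_encode, 𝒜.encode_eq, List.length_append, List.length_replicate,
      List.length_cons, 𝒜.length_table, Polynomial.eval_mul, Polynomial.eval_X,
      Polynomial.eval_ofNat]
    nlinarith
  · rintro ⟨w, -, n, 𝒜, C, rfl, -, hC⟩
    exact ⟨n, 𝒜, rfl, (hasDisjointUnionRepresentation_iff_exists_certifies 𝒜).2 ⟨C, hC⟩⟩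

end DisjointUnion

theorem mainTheorem11 :
    DisjointUnion.RepresentabilityProblem ∈ DisjointUnion.NP ∧
      DisjointUnion.IsPolyTimeVerifier
        DisjointUnion.CertificateRelation DisjointUnion.RepresentabilityProblem :=
  ⟨⟨_, DisjointUnion.isPolyTimeVerifier_certificateRelation⟩,
    DisjointUnion.isPolyTimeVerifier_certificateRelation⟩
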